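/- Let $\mathbb D$ be the open unit disc and $\mathbb T$ the unit circle in $\mathbb C$, and let $H^2(\mathbb D^2)$ be the Hardy space of holomorphic functions $f$ on $\mathbb D^2$ with $\sup_{0\le t<1}\int_{\mathbb T^2}|f(tz,tw)|^2\,dm<\infty$, where $m$ is normalized Lebesgue measure on $\mathbb T^2$. It is a Hilbert space with $\langle f,g\rangle=\sum_{m,n\ge0}a_{m,n}\overline{b_{m,n}}$ for $f=\sum a_{m,n}z^mw^n$ and $g=\sum b_{m,n}z^mw^n$. Let $M_1$ and $M_2$ be the operators of multiplication by the coordinates $z$ and $w$ on $H^2(\mathbb D^2)$. A quotient module is a closed subspace $\mathcal Q\subseteq H^2(\mathbb D^2)$ with $M_i^*\mathcal Q\subseteq\mathcal Q$ for $i=1,2$. With $P_{\mathcal Q}$ the orthogonal projection onto $\mathcal Q$ and $Q_i=P_{\mathcal Q}M_i|_{\mathcal Q}$, the quotient module $\mathcal Q$ is called $\varphi$-doubly commuting if $$Q_1Q_2Q_2^*=Q_2^*Q_1Q_2 .$$ An inner function on $\mathbb D$ is a bounded holomorphic function on $\mathbb D$ whose radial limits exist and have modulus $1$ at almost every point of $\mathbb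 T$. **Theorem 3.9.** Let $\theta_1$ and $\theta_2$ be inner functions on $\mathbb D$. Then the quotient module $$\mathcal Q=H^2(\mathbb D^2)\ominus\theta_1(z)\theta_2(w)H^2(\mathbb D^2)$$ is $\varphi$-doubly commuting if and only if one of the following holds: (i) $\theta_1$ and $\theta_2$ are constant functions; (ii) $\theta_1$ is constant and $\theta_2(w)=c\,\dfrac{w-b}{1-\bar b w}$ for some $b\in\mathbb D$ and $c\in\mathbb T$; (iii) $\theta_2$ is constant and $\theta_1(z)=c_1z$ for some $c_1\in\mathbb T$; (iv) $\theta_1(z)=c_1z$ and $\theta_2(w)=c_2w$ for some $c_1,c_2\in\mathbb T$. -/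

import Mathlib

open MeasureTheory Set Filter Topology ComplexConjugate

noncomputable section

/-- The open unit bidisc `𝔻²`. -/
def bidisc : Set (ℂ × ℂ) := Metric.ball (0 : ℂ) 1 ×ˢ Metric.ball (0 : ℂ) 1

/-- The point `(t e^{iα}, t e^{iβ})`. -/
def torusPt (t : ℝ) (p : ℝ × ℝ) : ℂ × ℂ :=
  (t * Complex.exp (p.1 * Complex.I), t * Complex.exp (p.2 * Complex.I))

/-- The square `[0, 2π]²` of arguments of the points of the torus. -/
abbrev argBox : Set (ℝ × ℝ) := Icc (0 : ℝ) (2 * Real.pi) ×ˢ Icc (0 : ℝ) (2 * Real.pi)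

/-- The mean of `|f(t·)|²` over the torus `𝕋²` with normalized Lebesgue measure. -/
def sqMean (t : ℝ) (f : ℂ × ℂ → ℂ) : ℝ :=
  (4 * Real.pi ^ 2)⁻¹ *
    ∫ p in argBox, ‖f (torusPt t p)‖ ^ 2

namespace HardyAux

lemma isCompact_box : IsCompact argBox := isCompact_Icc.prod isCompact_Icc

/-- The character `e^{i(mα+nβ)}`. -/
def chr (k : ℕ × ℕ) (p : ℝ × ℝ) : ℂ :=
  Complex.exp (p.1 * Complex.I) ^ k.1 * Complex.exp (p.2 * Complex.I) ^ k.2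

lemma continuous_chr (k : ℕ × ℕ) : Continuous (chr k) := by unfold chr; fun_prop

lemma norm_chr (k : ℕ × ℕ) (p : ℝ × ℝ) : ‖chr k p‖ = 1 := by
  simp [chr, Complex.norm_exp_ofReal_mul_I]

lemma orth1 (m k : ℕ) : (∫ x in Icc (0 : ℝ) (2 * Real.pi),
    conj (Complex.exp (x * Complex.I) ^ m) * Complex.exp (x * Complex.I) ^ k)
    = if m = k then (2 * Real.pi : ℂ) else 0 := by
  have h0 : (0 : ℝ) ≤ 2 * Real.pi := by positivity
  rw [integral_Icc_eq_integral_Ioc, ← intervalIntegral.integral_of_le h0]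
  have h1 : ∀ x : ℝ, conj (Complex.exp (x * Complex.I) ^ m) * Complex.exp (x * Complex.I) ^ k
      = Complex.exp ((((k : ℂ) - m) * Complex.I) * x) := by
    intro x
    rw [map_pow, ← Complex.exp_conj, ← Complex.exp_nat_mul, ← Complex.exp_nat_mul,
      ← Complex.exp_add]
    congr 1
    simp
    ring
  simp_rw [h1]
  split_ifs with h
  · subst h; simp
  · have hc : ((k : ℂ) - m) * Complex.I ≠ 0 := by
      refine mul_ne_zero (sub_ne_zero.2 ?_) Complex.I_ne_zero
      exact_mod_cast (Ne.symm h)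
    rw [integral_exp_mul_complex hc]
    have h2 : Complex.exp (((k : ℂ) - m) * Complex.I * ((2 * Real.pi : ℝ) : ℂ)) = 1 := by
      rw [Complex.exp_eq_one_iff]
      refine ⟨(k : ℤ) - m, ?_⟩
      push_cast
      ring
    rw [h2]
    simp

lemma orth (j k : ℕ × ℕ) : (∫ p in argBox, conj (chr j p) * chr k p)
    = if k = j then (4 * Real.pi ^ 2 : ℂ) else 0 := by
  have h1 : ∀ p : ℝ × ℝ, conj (chr j p) * chr k p =
      (conj (Complex.exp (p.1 * Complex.I) ^ j.1) * Complex.exp (p.1 * Complex.I) ^ k.1) *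
      (conj (Complex.exp (p.2 * Complex.I) ^ j.2) * Complex.exp (p.2 * Complex.I) ^ k.2) := by
    intro p
    simp only [chr, map_mul]
    ring
  simp_rw [h1]
  rw [Measure.volume_eq_prod, setIntegral_prod_mul (fun x : ℝ =>
      conj (Complex.exp (x * Complex.I) ^ j.1) * Complex.exp (x * Complex.I) ^ k.1)
      (fun x : ℝ => conj (Complex.exp (x * Complex.I) ^ j.2) * Complex.exp (x * Complex.I) ^ k.2),
    orth1, orth1]
  by_cases h : j.1 = k.1 <;> by_cases h' : j.2 = k.2 <;> simp [h, h', Prod.ext_iff, eq_comm]; ring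

lemma volume_box : (volume : Measure (ℝ × ℝ)).real argBox = 4 * Real.pi ^ 2 := by
  have h0 : (0 : ℝ) ≤ 2 * Real.pi := by positivity
  rw [Measure.volume_eq_prod, measureReal_prod_prod]
  simp [h0]
  ring

instance : IsFiniteMeasure ((volume : Measure (ℝ × ℝ)).restrict argBox) :=
  ⟨by rw [Measure.restrict_apply_univ]; exact isCompact_box.measure_lt_top⟩

lemma integrable_box {G : ℝ × ℝ → ℂ} (hG : Continuous G) :
    Integrable G ((volume : Measure (ℝ × ℝ)).restrict argBox) :=
  hG.continuousOn.integrableOn_compact isCompact_box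

lemma hasSum_int {ι : Type*} [Countable ι] {G : ι → ℝ × ℝ → ℂ} {u : ι → ℝ} (hu : Summable u)
    (hG : ∀ i, Continuous (G i)) (hb : ∀ i p, ‖G i p‖ ≤ u i) :
    HasSum (fun i => ∫ p in argBox, G i p) (∫ p in argBox, ∑' i, G i p) := by
  refine hasSum_integral_of_summable_integral_norm (fun i => integrable_box (hG i)) ?_
  refine Summable.of_nonneg_of_le (fun i => integral_nonneg fun _ => norm_nonneg _) (fun i => ?_)
    (hu.mul_left (4 * Real.pi ^ 2))
  calc (∫ p in argBox, ‖G i p‖) ≤ ∫ p in argBox, u i :=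
        integral_mono (integrable_box (hG i)).norm (integrable_const _) fun p => hb i p
    _ = 4 * Real.pi ^ 2 * u i := by
        rw [integral_const, smul_eq_mul, measureReal_restrict_apply_univ, volume_box]

lemma coeff_int {c : ℕ × ℕ → ℂ} (hc : Summable fun k => ‖c k‖) (j : ℕ × ℕ) :
    (∫ p in argBox, conj (chr j p) * ∑' k, c k * chr k p) = 4 * Real.pi ^ 2 * c j := by
  have h := hasSum_int (G := fun k p => conj (chr j p) * (c k * chr k p)) hc
    (fun k => (Complex.continuous_conj.comp (continuous_chr j)).mul
      (continuous_const.mul (continuous_chr k)))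
    (fun k p => by simp [norm_chr])
  simp_rw [tsum_mul_left] at h
  refine h.unique ?_
  have h2 : ∀ k, (∫ p in argBox, conj (chr j p) * (c k * chr k p)) =
      if k = j then (4 * Real.pi ^ 2 * c j : ℂ) else 0 := by
    intro k
    have : ∀ p, conj (chr j p) * (c k * chr k p) = c k * (conj (chr j p) * chr k p) := by
      intro p; ring
    simp_rw [this]
    rw [integral_const_mul, orth]
    split_ifs with hk
    · subst hk; ring
    · simp
  simp_rw [h2]
  exact hasSum_ite_eq j _

lemma parseval {c : ℕ × ℕ → ℂ} (hc : Summable fun k => ‖c k‖) :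
    (∫ p in argBox, ‖∑' k, c k * chr k p‖ ^ 2) = 4 * Real.pi ^ 2 * ∑' k, ‖c k‖ ^ 2 := by
  set F : ℝ × ℝ → ℂ := fun p => ∑' k, c k * chr k p with hF
  have hsum : ∀ p, Summable fun k => c k * chr k p := fun p =>
    Summable.of_norm (by simpa [norm_chr] using hc)
  have hFc : Continuous F :=
    continuous_tsum (fun k => continuous_const.mul (continuous_chr k)) hc
      (fun k p => by simp [norm_chr])
  have hFb : ∀ p, ‖F p‖ ≤ ∑' k, ‖c k‖ := fun p =>
    (norm_tsum_le_tsum_norm (by simpa [norm_chr] using hc)).trans (by simp [norm_chr])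
  have h := hasSum_int (G := fun k p => conj (c k * chr k p) * F p)
    (hc.mul_right (∑' k, ‖c k‖))
    (fun k => (Complex.continuous_conj.comp (continuous_const.mul (continuous_chr k))).mul hFc)
    (fun k p => by
      rw [norm_mul, RCLike.norm_conj, norm_mul, norm_chr, mul_one]
      exact mul_le_mul_of_nonneg_left (hFb p) (norm_nonneg _))
  have h1 : ∀ k, (∫ p in argBox, conj (c k * chr k p) * F p)
      = ((4 * Real.pi ^ 2 * ‖c k‖ ^ 2 : ℝ) : ℂ) := by
    intro k
    have : ∀ p, conj (c k * chr k p) * F p = conj (c k) * (conj (chr k p) * F p) := by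
      intro p; rw [map_mul]; ring
    simp_rw [this]
    rw [integral_const_mul, coeff_int hc]
    push_cast
    rw [← Complex.conj_mul']
    ring
  have h2 : ∀ p, (∑' k, conj (c k * chr k p) * F p) = ((‖F p‖ ^ 2 : ℝ) : ℂ) := by
    intro p
    rw [tsum_mul_right, ← Complex.conj_tsum]
    push_cast
    rw [← Complex.conj_mul']
  simp_rw [h1, h2] at h
  rw [integral_complex_ofReal] at h
  have h3 := Complex.hasSum_ofReal.1 h
  rw [← h3.tsum_eq, tsum_mul_left]


lemma continuous_torusPt (t : ℝ) : Continuous (torusPt t) := by unfold torusPt; fun_prop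

lemma mem_bidisc {p : ℂ × ℂ} : p ∈ bidisc ↔ ‖p.1‖ < 1 ∧ ‖p.2‖ < 1 := by
  simp [bidisc]

lemma isOpen_bidisc : IsOpen bidisc := Metric.isOpen_ball.prod Metric.isOpen_ball

lemma torusPt_mem {t : ℝ} (h0 : 0 ≤ t) (h1 : t < 1) (p : ℝ × ℝ) : torusPt t p ∈ bidisc := by
  rw [mem_bidisc]
  simp [torusPt, Complex.norm_exp_ofReal_mul_I, abs_of_nonneg h0, h1]

lemma continuous_comp_torusPt {f : ℂ × ℂ → ℂ} (hf : DifferentiableOn ℂ f bidisc) {t : ℝ}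
    (h0 : 0 ≤ t) (h1 : t < 1) : Continuous fun p => f (torusPt t p) :=
  hf.continuousOn.comp_continuous (continuous_torusPt t) (torusPt_mem h0 h1)

/-- The monomial `z^m w^n`. -/
def mono (k : ℕ × ℕ) (p : ℂ × ℂ) : ℂ := p.1 ^ k.1 * p.2 ^ k.2

lemma mono_torusPt (k : ℕ × ℕ) (t : ℝ) (p : ℝ × ℝ) :
    mono k (torusPt t p) = (t : ℂ) ^ (k.1 + k.2) * chr k p := by
  simp only [mono, torusPt, chr]
  ring

lemma cauchy1 {g : ℂ → ℂ} (hg : DifferentiableOn ℂ g (Metric.ball 0 1)) {r : ℝ} (hr1 : r < 1)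
    {z : ℂ} (hz : ‖z‖ < r) :
    g z = (2 * Real.pi : ℂ)⁻¹ * ∫ x in Icc (0 : ℝ) (2 * Real.pi),
      (1 - z / (r * Complex.exp (x * Complex.I)))⁻¹ * g (r * Complex.exp (x * Complex.I)) := by
  have h0 : (0 : ℝ) ≤ 2 * Real.pi := by positivity
  have hr0 : 0 < r := (norm_nonneg z).trans_lt hz
  have h := DifferentiableOn.circleIntegral_sub_inv_smul (f := g) (c := 0) (R := r) (w := z)
    (hg.mono (Metric.closedBall_subset_ball hr1)) (by simpa using hz)
  rw [integral_Icc_eq_integral_Ioc, ← intervalIntegral.integral_of_le h0]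
  rw [circleIntegral] at h
  have h1 : ∀ x : ℝ, deriv (circleMap 0 r) x • ((circleMap 0 r x - z)⁻¹ • g (circleMap 0 r x)) =
      Complex.I * ((1 - z / (r * Complex.exp (x * Complex.I)))⁻¹ *
        g (r * Complex.exp (x * Complex.I))) := by
    intro x
    have hu : (r * Complex.exp (x * Complex.I) : ℂ) ≠ 0 :=
      mul_ne_zero (by exact_mod_cast hr0.ne') (Complex.exp_ne_zero _)
    have hne : (r * Complex.exp (x * Complex.I) : ℂ) - z ≠ 0 := by
      intro h
      rw [sub_eq_zero] at h
      rw [← h] at hz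
      simp [Complex.norm_exp_ofReal_mul_I, abs_of_pos hr0] at hz
    simp only [deriv_circleMap, circleMap, zero_add, smul_eq_mul]
    rw [one_sub_div hu]
    field_simp
  simp_rw [h1] at h
  rw [intervalIntegral.integral_const_mul, smul_eq_mul] at h
  have hpi : (2 * Real.pi : ℂ) ≠ 0 := by simp [Real.pi_ne_zero]
  have h2 := mul_left_cancel₀ Complex.I_ne_zero (h.trans (show _ = Complex.I *
    (2 * Real.pi * g z) by ring))
  rw [h2, inv_mul_cancel_left₀ hpi]

/-- Taylor coefficients by Cauchy integrals at radius `r`. -/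
def cauchyCoeff (f : ℂ × ℂ → ℂ) (r : ℝ) (k : ℕ × ℕ) : ℂ :=
  (4 * Real.pi ^ 2 : ℂ)⁻¹ * ((r : ℂ) ^ (k.1 + k.2))⁻¹ *
    ∫ p in argBox, conj (chr k p) * f (torusPt r p)

lemma conj_exp_inv (x : ℝ) :
    (Complex.exp (x * Complex.I))⁻¹ = conj (Complex.exp (x * Complex.I)) := by
  rw [← Complex.exp_conj, ← Complex.exp_neg]
  simp

lemma cauchy2 {f : ℂ × ℂ → ℂ} (hf : DifferentiableOn ℂ f bidisc) {r : ℝ} (hr1 : r < 1)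
    {q : ℂ × ℂ} (hz : ‖q.1‖ < r) (hw : ‖q.2‖ < r) :
    HasSum (fun k => cauchyCoeff f r k * mono k q) (f q) := by
  have hr0 : 0 < r := (norm_nonneg _).trans_lt hz
  have hrc : (r : ℂ) ≠ 0 := by exact_mod_cast hr0.ne'
  obtain ⟨z, w⟩ := q
  simp only at hz hw
  set u : ℝ → ℂ := fun x => r * Complex.exp (x * Complex.I) with hu
  have hune : ∀ x, u x ≠ 0 := fun x => mul_ne_zero hrc (Complex.exp_ne_zero _)
  have hun : ∀ x, ‖u x‖ = r := fun x => by
    simp [hu, Complex.norm_exp_ofReal_mul_I, abs_of_pos hr0]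
  have huc : Continuous u := by simp only [hu]; fun_prop
  have hq : ∀ {z : ℂ}, ‖z‖ < r → ∀ x, ‖z / u x‖ = ‖z‖ / r := fun h x => by rw [norm_div, hun]
  have hq1 : ∀ {z : ℂ}, ‖z‖ < r → ‖z‖ / r < 1 := fun h => (div_lt_one hr0).2 h
  have hne : ∀ {z : ℂ}, ‖z‖ < r → ∀ x, 1 - z / u x ≠ 0 := by
    intro z h x h'
    have h2 := hq h x
    rw [← sub_eq_zero.1 h'] at h2
    simp at h2
    linarith [hq1 h]
  have hut : ∀ p : ℝ × ℝ, torusPt r p = (u p.1, u p.2) := fun p => rfl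
  -- the iterated Cauchy formula
  have hA : f (z, w) = (4 * Real.pi ^ 2 : ℂ)⁻¹ * ∫ p in argBox,
      (1 - z / u p.1)⁻¹ * (1 - w / u p.2)⁻¹ * f (torusPt r p) := by
    have e1 := cauchy1 (g := fun s => f (s, w)) (r := r) (z := z) (by
      refine hf.comp (f := fun s => (s, w)) (by fun_prop) ?_
      intro s hs
      rw [mem_bidisc]
      exact ⟨by simpa using hs, hw.trans hr1⟩) hr1 hz
    have e2 : ∀ x, f (u x, w) = (2 * Real.pi : ℂ)⁻¹ * ∫ y in Icc (0 : ℝ) (2 * Real.pi),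
        (1 - w / u y)⁻¹ * f (u x, u y) := fun x =>
      cauchy1 (g := fun s => f (u x, s)) (r := r) (z := w) (by
        refine hf.comp (f := fun s => (u x, s)) (by fun_prop) ?_
        intro s hs
        rw [mem_bidisc]
        exact ⟨by simpa [hun] using hr1, by simpa using hs⟩) hr1 hw
    rw [Measure.volume_eq_prod, setIntegral_prod]
    · simp only [hut]
      change f (z, w) = _ * ∫ x in Icc (0 : ℝ) (2 * Real.pi), (1 - z / u x)⁻¹ * f (u x, w) at e1
      rw [e1]
      simp_rw [e2]
      have : ∀ x, (1 - z / u x)⁻¹ * ((2 * Real.pi : ℂ)⁻¹ * ∫ y in Icc (0 : ℝ) (2 * Real.pi),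
          (1 - w / u y)⁻¹ * f (u x, u y)) = (2 * Real.pi : ℂ)⁻¹ *
          ∫ y in Icc (0 : ℝ) (2 * Real.pi), (1 - z / u x)⁻¹ * (1 - w / u y)⁻¹ * f (u x, u y) := by
        intro x
        simp_rw [mul_assoc]
        rw [integral_const_mul]
        ring
      simp_rw [this]
      rw [integral_const_mul, ← mul_assoc]
      congr 1
      rw [← mul_inv]
      ring
    · refine ContinuousOn.integrableOn_compact isCompact_box (Continuous.continuousOn ?_)
      have c1 : Continuous fun p : ℝ × ℝ => (1 - z / u p.1)⁻¹ :=
        (continuous_const.sub (continuous_const.div (huc.comp continuous_fst)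
          fun p => hune _)).inv₀ fun p => hne hz _
      have c2 : Continuous fun p : ℝ × ℝ => (1 - w / u p.2)⁻¹ :=
        (continuous_const.sub (continuous_const.div (huc.comp continuous_snd)
          fun p => hune _)).inv₀ fun p => hne hw _
      exact (c1.mul c2).mul (continuous_comp_torusPt hf hr0.le hr1)
  -- termwise integration
  have hfc := continuous_comp_torusPt hf hr0.le hr1
  obtain ⟨B, hB⟩ : ∃ B, ∀ p, ‖f (torusPt r p)‖ ≤ B := by
    have hK : IsCompact (Metric.closedBall (0 : ℂ) r ×ˢ Metric.closedBall (0 : ℂ) r) :=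
      (isCompact_closedBall _ _).prod (isCompact_closedBall _ _)
    obtain ⟨B, hB⟩ := hK.exists_bound_of_continuousOn (f := f) (hf.continuousOn.mono (by
      rintro p ⟨h1, h2⟩
      rw [mem_bidisc]
      simp at h1 h2
      exact ⟨h1.trans_lt hr1, h2.trans_lt hr1⟩))
    refine ⟨B, fun p => hB _ ?_⟩
    rw [hut]
    constructor <;> simp [hun]
  have hgeo : ∀ {z : ℂ}, ‖z‖ < r → Summable fun n : ℕ => (‖z‖ / r) ^ n := fun h =>
    summable_geometric_of_lt_one (by positivity) (hq1 h)
  have hs : Summable fun k : ℕ × ℕ => (‖z‖ / r) ^ k.1 * (‖w‖ / r) ^ k.2 :=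
    (hgeo hz).mul_of_nonneg (hgeo hw) (fun _ => by positivity) (fun _ => by positivity)
  have h := hasSum_int
    (G := fun k p => (z / u p.1) ^ k.1 * (w / u p.2) ^ k.2 * f (torusPt r p)) (hs.mul_right B)
    (fun k => (((continuous_const.div (huc.comp continuous_fst) fun p => hune _).pow _).mul
      ((continuous_const.div (huc.comp continuous_snd) fun p => hune _).pow _)).mul hfc)
    (fun k p => by
      rw [norm_mul, norm_mul, norm_pow, norm_pow, hq hz, hq hw]
      exact mul_le_mul_of_nonneg_left (hB p) (by positivity))
  have h1 : ∀ p : ℝ × ℝ, (∑' k : ℕ × ℕ, (z / u p.1) ^ k.1 * (w / u p.2) ^ k.2 * f (torusPt r p))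
      = (1 - z / u p.1)⁻¹ * (1 - w / u p.2)⁻¹ * f (torusPt r p) := by
    intro p
    rw [tsum_mul_right, ← tsum_geometric_of_norm_lt_one (ξ := z / u p.1)
      (by rw [hq hz]; exact hq1 hz), ← tsum_geometric_of_norm_lt_one (ξ := w / u p.2)
      (by rw [hq hw]; exact hq1 hw), tsum_mul_tsum_of_summable_norm]
    · simp_rw [norm_pow, hq hz]; exact hgeo hz
    · simp_rw [norm_pow, hq hw]; exact hgeo hw
  simp_rw [h1] at h
  have h2 := h.mul_left (4 * Real.pi ^ 2 : ℂ)⁻¹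
  rw [← hA] at h2
  convert! h2 using 2 with k
  have h3 : ∀ p : ℝ × ℝ, (z / u p.1) ^ k.1 * (w / u p.2) ^ k.2 * f (torusPt r p) =
      (((r : ℂ) ^ (k.1 + k.2))⁻¹ * mono k (z, w)) * (conj (chr k p) * f (torusPt r p)) := by
    intro p
    simp only [mono, chr, hu, map_mul, map_pow, ← conj_exp_inv, mul_pow, inv_pow, pow_add,
      mul_inv, div_eq_mul_inv]
    ring
  simp_rw [h3]
  rw [integral_const_mul, cauchyCoeff]
  ring

lemma sqMean_of_hasSum {f : ℂ × ℂ → ℂ} {a : ℕ × ℕ → ℂ}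
    (h : ∀ p ∈ bidisc, HasSum (fun k => a k * mono k p) (f p)) {t : ℝ} (h0 : 0 ≤ t) (h1 : t < 1) :
    (Summable fun k => ‖a k * (t : ℂ) ^ (k.1 + k.2)‖) ∧
    (∀ p, f (torusPt t p) = ∑' k, a k * (t : ℂ) ^ (k.1 + k.2) * chr k p) := by
  refine ⟨?_, fun p => ?_⟩
  · have := (h _ (torusPt_mem h0 h1 0)).summable.norm
    refine this.congr fun k => ?_
    rw [mono_torusPt, norm_mul, norm_mul, norm_mul, norm_chr, mul_one]
  · rw [← (h _ (torusPt_mem h0 h1 p)).tsum_eq]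
    refine tsum_congr fun k => ?_
    rw [mono_torusPt, mul_assoc]

lemma sqMean_eq {f : ℂ × ℂ → ℂ} {a : ℕ × ℕ → ℂ}
    (h : ∀ p ∈ bidisc, HasSum (fun k => a k * mono k p) (f p)) {t : ℝ} (h0 : 0 ≤ t) (h1 : t < 1) :
    sqMean t f = ∑' k, ‖a k * (t : ℂ) ^ (k.1 + k.2)‖ ^ 2 := by
  obtain ⟨hs, hf⟩ := sqMean_of_hasSum h h0 h1
  rw [sqMean]
  simp_rw [hf]
  rw [parseval hs, inv_mul_cancel_left₀ (by positivity)]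

lemma cauchyCoeff_eq {f : ℂ × ℂ → ℂ} {a : ℕ × ℕ → ℂ}
    (h : ∀ p ∈ bidisc, HasSum (fun k => a k * mono k p) (f p)) {t : ℝ} (h0 : 0 < t) (h1 : t < 1)
    (j : ℕ × ℕ) : cauchyCoeff f t j = a j := by
  obtain ⟨hs, hf⟩ := sqMean_of_hasSum h h0.le h1
  rw [cauchyCoeff]
  simp_rw [hf]
  rw [coeff_int hs]
  have : (t : ℂ) ≠ 0 := by exact_mod_cast h0.ne'
  have : (Real.pi : ℂ) ≠ 0 := by exact_mod_cast Real.pi_ne_zero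
  field_simp

/-- Holomorphic functions on the bidisc are sums of their Taylor series. -/
lemma taylor {f : ℂ × ℂ → ℂ} (hf : DifferentiableOn ℂ f bidisc) {p : ℂ × ℂ} (hp : p ∈ bidisc) :
    HasSum (fun k => cauchyCoeff f (1 / 2) k * mono k p) (f p) := by
  rw [mem_bidisc] at hp
  obtain ⟨r, hr, hr1⟩ := exists_between (max_lt (max_lt hp.1 hp.2) (show (1 / 2 : ℝ) < 1 by norm_num))
  simp only [max_lt_iff] at hr
  have key : ∀ j, cauchyCoeff f (1 / 2) j = cauchyCoeff f r j := by
    intro j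
    have hs : Summable fun k => ‖cauchyCoeff f r k * ((1 / 2 : ℝ) : ℂ) ^ (k.1 + k.2)‖ := by
      have := (cauchy2 hf hr1 (q := torusPt (1 / 2) 0)
        (by simpa [torusPt] using hr.2) (by simpa [torusPt] using hr.2)).summable.norm
      refine this.congr fun k => ?_
      rw [mono_torusPt, norm_mul, norm_mul, norm_mul, norm_chr, mul_one]
    have he : ∀ p, f (torusPt (1 / 2) p) =
        ∑' k, cauchyCoeff f r k * ((1 / 2 : ℝ) : ℂ) ^ (k.1 + k.2) * chr k p := by
      intro p
      rw [← (cauchy2 hf hr1 (q := torusPt (1 / 2) p)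
        (by simpa [torusPt, Complex.norm_exp_ofReal_mul_I] using hr.2)
        (by simpa [torusPt, Complex.norm_exp_ofReal_mul_I] using hr.2)).tsum_eq]
      refine tsum_congr fun k => ?_
      rw [mono_torusPt, mul_assoc]
    rw [cauchyCoeff]
    simp_rw [he]
    rw [coeff_int hs]
    have : (Real.pi : ℂ) ≠ 0 := by exact_mod_cast Real.pi_ne_zero
    field_simp
  simp_rw [key]
  exact cauchy2 hf hr1 hr.1.1 hr.1.2

lemma summable_bdd {a : ℕ × ℕ → ℂ} {C : ℝ} (hC : ∀ k, ‖a k‖ ≤ C) {p : ℂ × ℂ} (hp : p ∈ bidisc) :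
    Summable fun k => a k * mono k p := by
  rw [mem_bidisc] at hp
  refine Summable.of_norm_bounded (g := fun k => C * (‖p.1‖ ^ k.1 * ‖p.2‖ ^ k.2))
    (Summable.mul_left _ ((summable_geometric_of_lt_one (norm_nonneg _) hp.1).mul_of_nonneg
      (summable_geometric_of_lt_one (norm_nonneg _) hp.2) (fun _ => by positivity)
      (fun _ => by positivity))) fun k => ?_
  rw [mono, norm_mul, norm_mul, norm_pow, norm_pow]
  exact mul_le_mul_of_nonneg_right (hC k) (by positivity)

/-- The derivative of a monomial. -/
def dmono (k : ℕ × ℕ) (q : ℂ × ℂ) : ℂ × ℂ →L[ℂ] ℂ :=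
  (q.1 ^ k.1 * ((k.2 : ℂ) * q.2 ^ (k.2 - 1))) • ContinuousLinearMap.snd ℂ ℂ ℂ +
    (q.2 ^ k.2 * ((k.1 : ℂ) * q.1 ^ (k.1 - 1))) • ContinuousLinearMap.fst ℂ ℂ ℂ

lemma hasFDerivAt_mono (k : ℕ × ℕ) (q : ℂ × ℂ) : HasFDerivAt (mono k) (dmono k q) q := by
  have h1 : HasFDerivAt (fun q : ℂ × ℂ => q.1 ^ k.1)
      (((k.1 : ℂ) * q.1 ^ (k.1 - 1)) • ContinuousLinearMap.fst ℂ ℂ ℂ) q :=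
    (hasDerivAt_pow k.1 q.1).comp_hasFDerivAt q hasFDerivAt_fst
  have h2 : HasFDerivAt (fun q : ℂ × ℂ => q.2 ^ k.2)
      (((k.2 : ℂ) * q.2 ^ (k.2 - 1)) • ContinuousLinearMap.snd ℂ ℂ ℂ) q :=
    (hasDerivAt_pow k.2 q.2).comp_hasFDerivAt q hasFDerivAt_snd
  have h3 := h1.mul h2
  rw [smul_smul, smul_smul] at h3
  exact h3

lemma norm_dmono_le (k : ℕ × ℕ) {q : ℂ × ℂ} {r : ℝ} (h1 : ‖q.1‖ ≤ r) (h2 : ‖q.2‖ ≤ r) :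
    ‖dmono k q‖ ≤ r ^ k.1 * (k.2 * r ^ (k.2 - 1)) + (k.1 * r ^ (k.1 - 1)) * r ^ k.2 := by
  have hr : 0 ≤ r := (norm_nonneg _).trans h1
  have hf := ContinuousLinearMap.norm_fst_le ℂ ℂ ℂ
  have hg := ContinuousLinearMap.norm_snd_le ℂ ℂ ℂ
  refine (norm_add_le _ _).trans (add_le_add ?_ ?_)
  · rw [norm_smul, norm_mul, norm_mul, norm_pow, norm_pow, Complex.norm_natCast]
    refine (mul_le_of_le_one_right (by positivity) hg).trans ?_
    gcongr
  · rw [norm_smul, norm_mul, norm_mul, norm_pow, norm_pow, Complex.norm_natCast,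
      mul_comm (_ * _) (r ^ k.2)]
    refine (mul_le_of_le_one_right (by positivity) hf).trans ?_
    gcongr

lemma summable_deriv {r : ℝ} (hr0 : 0 ≤ r) (hr1 : r < 1) :
    Summable fun k : ℕ × ℕ => r ^ k.1 * ((k.2 : ℝ) * r ^ (k.2 - 1)) +
      ((k.1 : ℝ) * r ^ (k.1 - 1)) * r ^ k.2 := by
  have hgeo : Summable fun n : ℕ => r ^ n := summable_geometric_of_lt_one hr0 hr1
  have hder : Summable fun n : ℕ => (n : ℝ) * r ^ (n - 1) := by
    rw [← summable_nat_add_iff 1]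
    have h1 := summable_pow_mul_geometric_of_norm_lt_one 1 (r := r)
      (by rwa [Real.norm_of_nonneg hr0])
    refine (h1.add hgeo).congr fun n => ?_
    push_cast
    simp
    ring
  have hg0 : 0 ≤ fun n : ℕ => r ^ n := fun n => pow_nonneg hr0 n
  have hd0 : 0 ≤ fun n : ℕ => (n : ℝ) * r ^ (n - 1) := fun n =>
    mul_nonneg n.cast_nonneg (pow_nonneg hr0 _)
  exact (hgeo.mul_of_nonneg hder hg0 hd0).add (hder.mul_of_nonneg hgeo hd0 hg0)

lemma differentiableOn_series {a : ℕ × ℕ → ℂ} {C : ℝ} (hC : ∀ k, ‖a k‖ ≤ C) :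
    DifferentiableOn ℂ (fun p => ∑' k, a k * mono k p) bidisc := by
  intro p hp
  refine DifferentiableAt.differentiableWithinAt ?_
  have hp' := mem_bidisc.1 hp
  obtain ⟨r, hr, hr1⟩ := exists_between (max_lt hp'.1 hp'.2)
  rw [max_lt_iff] at hr
  have hr0 : 0 < r := (norm_nonneg _).trans_lt hr.1
  have hps : p ∈ Metric.ball (0 : ℂ) r ×ˢ Metric.ball (0 : ℂ) r := by simp [hr]
  have hf : ∀ k q, q ∈ Metric.ball (0 : ℂ) r ×ˢ Metric.ball (0 : ℂ) r →
      HasFDerivAt (fun q => a k * mono k q) (a k • dmono k q) q :=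
    fun k q _ => (hasFDerivAt_mono k q).const_mul (a k)
  have hb : ∀ k q, q ∈ Metric.ball (0 : ℂ) r ×ˢ Metric.ball (0 : ℂ) r →
      ‖a k • dmono k q‖ ≤ C * (r ^ k.1 * (k.2 * r ^ (k.2 - 1)) +
        (k.1 * r ^ (k.1 - 1)) * r ^ k.2) := by
    intro k q hq
    simp only [mem_prod, Metric.mem_ball, dist_zero_right] at hq
    rw [norm_smul]
    exact mul_le_mul (hC k) (norm_dmono_le k hq.1.le hq.2.le) (norm_nonneg _)
      ((norm_nonneg _).trans (hC k))
  exact (hasFDerivAt_tsum_of_isPreconnected ((summable_deriv hr0.le hr1).mul_left C)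
    (Metric.isOpen_ball.prod Metric.isOpen_ball)
    ((convex_ball (0 : ℂ) r).prod (convex_ball (0 : ℂ) r)).isPreconnected hf hb hps
    (summable_bdd hC hp) hps).differentiableAt

end HardyAux

/-- The Hardy space `H²(𝔻²)` as a space of functions: holomorphic functions on the bidisc
(extended by zero outside of it) whose square means over the tori of radius `t < 1` are bounded. -/
def hardySubmodule : Submodule ℂ (ℂ × ℂ → ℂ) where
  carrier := {f | DifferentiableOn ℂ f bidisc ∧ (∀ p, p ∉ bidisc → f p = 0) ∧
    ∃ C : ℝ, ∀ t : ℝ, 0 ≤ t → t < 1 → sqMean t f ≤ C}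
  zero_mem' := ⟨differentiableOn_const 0, fun _ _ => rfl, 0, fun t _ _ => by simp [sqMean]⟩
  add_mem' := by
    rintro f g ⟨hf, hf0, C, hC⟩ ⟨hg, hg0, D, hD⟩
    refine ⟨hf.add hg, fun p hp => by simp [hf0 p hp, hg0 p hp], 2 * C + 2 * D, fun t h0 h1 => ?_⟩
    refine le_trans ?_ (add_le_add (mul_le_mul_of_nonneg_left (hC t h0 h1) zero_le_two)
      (mul_le_mul_of_nonneg_left (hD t h0 h1) zero_le_two))
    have cf := HardyAux.continuous_comp_torusPt hf h0 h1
    have cg := HardyAux.continuous_comp_torusPt hg h0 h1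
    have hi : ∀ {G : ℝ × ℝ → ℝ}, Continuous G → IntegrableOn G argBox := fun hG =>
      hG.continuousOn.integrableOn_compact HardyAux.isCompact_box
    have i1 : IntegrableOn (fun p => ‖f (torusPt t p)‖ ^ 2) argBox := hi (cf.norm.pow 2)
    have i2 : IntegrableOn (fun p => ‖g (torusPt t p)‖ ^ 2) argBox := hi (cg.norm.pow 2)
    have i3 : IntegrableOn (fun p => ‖f (torusPt t p) + g (torusPt t p)‖ ^ 2) argBox :=
      hi ((cf.add cg).norm.pow 2)
    have key : (∫ p in argBox, ‖f (torusPt t p) + g (torusPt t p)‖ ^ 2) ≤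
        2 * (∫ p in argBox, ‖f (torusPt t p)‖ ^ 2) + 2 * ∫ p in argBox, ‖g (torusPt t p)‖ ^ 2 := by
      rw [← integral_const_mul, ← integral_const_mul,
        ← integral_add (i1.const_mul 2) (i2.const_mul 2)]
      refine integral_mono i3 ((i1.const_mul 2).add (i2.const_mul 2)) fun p => ?_
      have := norm_add_le (f (torusPt t p)) (g (torusPt t p))
      nlinarith [norm_nonneg (f (torusPt t p) + g (torusPt t p)),
        sq_nonneg (‖f (torusPt t p)‖ - ‖g (torusPt t p)‖)]
    simp only [sqMean, Pi.add_apply]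
    calc _ ≤ (4 * Real.pi ^ 2)⁻¹ * _ := mul_le_mul_of_nonneg_left key (by positivity)
      _ = _ := by ring
  smul_mem' := by
    rintro c f ⟨hf, hf0, C, hC⟩
    refine ⟨hf.const_smul c, fun p hp => by simp [hf0 p hp], ‖c‖ ^ 2 * C, fun t h0 h1 => ?_⟩
    refine le_trans (le_of_eq ?_) (mul_le_mul_of_nonneg_left (hC t h0 h1) (sq_nonneg ‖c‖))
    simp only [sqMean, Pi.smul_apply, smul_eq_mul, norm_mul, mul_pow]
    rw [integral_const_mul]
    ring

/-- The Hardy space `H²(𝔻²)`. -/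
def HardyBidisc : Type := hardySubmodule

namespace HardyBidisc

instance : AddCommGroup HardyBidisc := inferInstanceAs (AddCommGroup hardySubmodule)

instance : Module ℂ HardyBidisc := inferInstanceAs (Module ℂ hardySubmodule)

instance : CoeFun HardyBidisc fun _ => ℂ × ℂ → ℂ := ⟨fun f => f.1⟩

lemma ext_bidisc {f g : HardyBidisc} (h : ∀ p ∈ bidisc, f p = g p) : f = g := by
  refine Subtype.ext (funext fun p => ?_)
  by_cases hp : p ∈ bidisc
  · exact h p hp
  · rw [f.2.2.1 p hp, g.2.2.1 p hp]

/-- The Taylor coefficient `a_{m,n}` of `f = ∑ a_{m,n} z^m w^n`, for `k = (m, n)`. -/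
def coeff (f : HardyBidisc) (k : ℕ × ℕ) : ℂ := HardyAux.cauchyCoeff f (1 / 2) k

lemma hasSum (f : HardyBidisc) {p : ℂ × ℂ} (hp : p ∈ bidisc) :
    HasSum (fun k : ℕ × ℕ => coeff f k * (p.1 ^ k.1 * p.2 ^ k.2)) (f p) :=
  HardyAux.taylor f.2.1 hp

lemma coeff_unique (f : HardyBidisc) {a : ℕ × ℕ → ℂ}
    (h : ∀ p ∈ bidisc, HasSum (fun k => a k * (p.1 ^ k.1 * p.2 ^ k.2)) (f p)) : coeff f = a :=
  funext fun k => HardyAux.cauchyCoeff_eq h (by norm_num) (by norm_num) k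

lemma sqMean_eq (f : HardyBidisc) {t : ℝ} (h0 : 0 ≤ t) (h1 : t < 1) :
    HasSum (fun k => ‖coeff f k * (t : ℂ) ^ (k.1 + k.2)‖ ^ 2) (sqMean t f) := by
  have h : ∀ p ∈ bidisc, HasSum (fun k => coeff f k * HardyAux.mono k p) (f p) :=
    fun p hp => f.hasSum hp
  rw [HardyAux.sqMean_eq h h0 h1]
  have hs := (HardyAux.sqMean_of_hasSum h h0 h1).1
  refine Summable.hasSum ?_
  refine (hs.mul_of_nonneg hs (fun _ => norm_nonneg _) fun _ => norm_nonneg _).comp_injective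
    (i := fun k => (k, k)) (fun a b h => (Prod.ext_iff.1 h).1) |>.congr fun k => ?_
  simp [sq]

lemma sum_sq_le (f : HardyBidisc) {C : ℝ} (hC : ∀ t : ℝ, 0 ≤ t → t < 1 → sqMean t f ≤ C)
    (s : Finset (ℕ × ℕ)) : ∑ k ∈ s, ‖coeff f k‖ ^ 2 ≤ C := by
  have hc : Continuous fun t : ℝ => ∑ k ∈ s, ‖coeff f k * (t : ℂ) ^ (k.1 + k.2)‖ ^ 2 := by
    fun_prop
  have ht : Tendsto (fun t : ℝ => ∑ k ∈ s, ‖coeff f k * (t : ℂ) ^ (k.1 + k.2)‖ ^ 2) (𝓝[<] 1)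
      (𝓝 (∑ k ∈ s, ‖coeff f k‖ ^ 2)) := by
    have := (hc.tendsto 1).mono_left (nhdsWithin_le_nhds (s := Iio 1))
    simpa using this
  refine le_of_tendsto ht ?_
  filter_upwards [Ioo_mem_nhdsLT (show (0 : ℝ) < 1 by norm_num)] with t ht
  exact (sum_le_hasSum s (fun _ _ => by positivity) (f.sqMean_eq ht.1.le ht.2)).trans
    (hC t ht.1.le ht.2)

lemma summable_sq (f : HardyBidisc) : Summable fun k => ‖coeff f k‖ ^ 2 := by
  obtain ⟨C, hC⟩ := f.2.2.2
  exact summable_of_sum_le (fun _ => by positivity) (f.sum_sq_le hC)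

/-- The Taylor coefficients of a function in `H²(𝔻²)`, as an element of `ℓ²(ℕ × ℕ)`. -/
def coeffs : HardyBidisc →ₗ[ℂ] lp (fun _ : ℕ × ℕ => ℂ) 2 where
  toFun f := ⟨coeff f, memℓp_gen (by simpa using f.summable_sq)⟩
  map_add' f g := Subtype.ext <| coeff_unique (f + g) fun p hp => by
    have h := (f.hasSum hp).add (g.hasSum hp)
    simp_rw [← add_mul] at h
    exact h
  map_smul' c f := Subtype.ext <| coeff_unique (c • f) fun p hp => by
    simpa [mul_assoc] using! (f.hasSum hp).mul_left c

lemma coeffs_injective : Function.Injective coeffs := fun f g h => ext_bidisc fun p hp => by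
  have h' : coeff f = coeff g := congrArg Subtype.val h
  exact (f.hasSum hp).unique (h' ▸ g.hasSum hp)

lemma coeffs_surjective : Function.Surjective coeffs := by
  intro a
  have hb : ∀ k, ‖a k‖ ≤ ‖a‖ := fun k => lp.norm_apply_le_norm two_ne_zero a k
  have hsq : Summable fun k => ‖a k‖ ^ 2 := by
    simpa using (lp.memℓp a).summable (by norm_num)
  set F : ℂ × ℂ → ℂ := bidisc.indicator fun p => ∑' k, a k * HardyAux.mono k p with hF
  have hs : ∀ p ∈ bidisc, HasSum (fun k => a k * HardyAux.mono k p) (F p) := fun p hp => by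
    rw [hF, indicator_of_mem hp]
    exact (HardyAux.summable_bdd hb hp).hasSum
  refine ⟨⟨F, ?_, fun p hp => indicator_of_notMem hp _, ∑' k, ‖a k‖ ^ 2, fun t h0 h1 => ?_⟩, ?_⟩
  · exact (HardyAux.differentiableOn_series hb).congr fun p hp => indicator_of_mem hp _
  · rw [HardyAux.sqMean_eq hs h0 h1]
    have hle : ∀ k : ℕ × ℕ, ‖a k * (t : ℂ) ^ (k.1 + k.2)‖ ^ 2 ≤ ‖a k‖ ^ 2 := fun k => by
      refine pow_le_pow_left₀ (norm_nonneg _) ?_ 2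
      rw [norm_mul, norm_pow, Complex.norm_real, Real.norm_of_nonneg h0]
      exact mul_le_of_le_one_right (norm_nonneg _) (pow_le_one₀ h0 h1.le)
    exact (hsq.of_nonneg_of_le (fun _ => by positivity) hle).tsum_le_tsum hle hsq
  · exact Subtype.ext (coeff_unique _ hs)

/-- The norm of `H²(𝔻²)` is the `ℓ²` norm of the Taylor coefficients. -/
instance : NormedAddCommGroup HardyBidisc :=
  NormedAddCommGroup.induced HardyBidisc (lp (fun _ : ℕ × ℕ => ℂ) 2) coeffs coeffs_injective

lemma norm_coeffs (f : HardyBidisc) : ‖coeffs f‖ = ‖f‖ := rfl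

/-- The inner product `∑ conj (a_{m,n}) b_{m,n}` of `H²(𝔻²)`. -/
instance : InnerProductSpace ℂ HardyBidisc where
  norm_smul_le c f := by
    rw [← norm_coeffs, ← norm_coeffs, map_smul, norm_smul]
  inner f g := inner ℂ (coeffs f) (coeffs g)
  norm_sq_eq_re_inner f := by
    rw [← norm_coeffs]; exact InnerProductSpace.norm_sq_eq_re_inner (𝕜 := ℂ) (coeffs f)
  conj_inner_symm f g := inner_conj_symm (coeffs f) (coeffs g)
  add_left f g h := by rw [map_add, inner_add_left]
  smul_left f g c := by rw [map_smul, inner_smul_left]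

/-- `H²(𝔻²)` is isometrically isomorphic to `ℓ²(ℕ × ℕ)`. -/
def coeffsEquiv : HardyBidisc ≃ₗᵢ[ℂ] lp (fun _ : ℕ × ℕ => ℂ) 2 where
  toLinearEquiv := LinearEquiv.ofBijective coeffs ⟨coeffs_injective, coeffs_surjective⟩
  norm_map' := norm_coeffs

instance : CompleteSpace HardyBidisc :=
  coeffsEquiv.toIsometryEquiv.completeSpace

/-- The square of the norm is the supremum of the square means, as usual for Hardy spaces. -/
lemma isLUB_norm_sq (f : HardyBidisc) : IsLUB ((fun t => sqMean t f) '' Ico 0 1) (‖f‖ ^ 2) := by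
  have hn : HasSum (fun k => ‖coeff f k‖ ^ 2) (‖f‖ ^ 2) := by
    have := lp.hasSum_norm (p := 2) (by norm_num) (coeffs f)
    simpa [norm_coeffs] using! this
  constructor
  · rintro _ ⟨t, ⟨h0, h1⟩, rfl⟩
    refine hasSum_le (fun k => ?_) (f.sqMean_eq h0 h1) hn
    refine pow_le_pow_left₀ (norm_nonneg _) ?_ 2
    rw [norm_mul, norm_pow, Complex.norm_real, Real.norm_of_nonneg h0]
    exact mul_le_of_le_one_right (norm_nonneg _) (pow_le_one₀ h0 h1.le)
  · intro C hC
    refine hasSum_le_of_sum_le hn (f.sum_sq_le fun t h0 h1 => hC ⟨t, ⟨h0, h1⟩, rfl⟩)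

lemma sqMean_mul_le {φ f : ℂ × ℂ → ℂ} (hφ : DifferentiableOn ℂ φ bidisc)
    (hφ1 : ∀ p ∈ bidisc, ‖φ p‖ ≤ 1) (hf : DifferentiableOn ℂ f bidisc) {t : ℝ} (h0 : 0 ≤ t)
    (h1 : t < 1) : sqMean t (fun p => φ p * f p) ≤ sqMean t f := by
  have hi : ∀ {G : ℝ × ℝ → ℂ}, Continuous G → IntegrableOn (fun p => ‖G p‖ ^ 2) argBox :=
    fun hG => (hG.norm.pow 2).continuousOn.integrableOn_compact HardyAux.isCompact_box
  have c1 := HardyAux.continuous_comp_torusPt hφ h0 h1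
  have c2 := HardyAux.continuous_comp_torusPt hf h0 h1
  refine mul_le_mul_of_nonneg_left ?_ (by positivity)
  refine integral_mono (hi (c1.mul c2)) (hi c2) fun p => ?_
  refine pow_le_pow_left₀ (norm_nonneg _) ?_ 2
  rw [norm_mul]
  exact mul_le_of_le_one_left (norm_nonneg _) (hφ1 _ (HardyAux.torusPt_mem h0 h1 p))

/-- Multiplication on `H²(𝔻²)` by a holomorphic function bounded by one. -/
def mulOp (φ : ℂ × ℂ → ℂ) (hφ : DifferentiableOn ℂ φ bidisc) (hφ1 : ∀ p ∈ bidisc, ‖φ p‖ ≤ 1) :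
    HardyBidisc →L[ℂ] HardyBidisc :=
  LinearMap.mkContinuous
    { toFun := fun f => ⟨fun p => φ p * f p, hφ.mul f.2.1, fun p hp => by simp [f.2.2.1 p hp],
        ‖f‖ ^ 2, fun t h0 h1 => (sqMean_mul_le hφ hφ1 f.2.1 h0 h1).trans
          (f.isLUB_norm_sq.1 ⟨t, ⟨h0, h1⟩, rfl⟩)⟩
      map_add' := fun f g => Subtype.ext <| funext fun p => mul_add _ (f p) (g p)
      map_smul' := fun c f => Subtype.ext <| funext fun p => mul_left_comm (φ p) c (f p) } 1
    fun f => by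
      rw [one_mul]
      refine le_of_sq_le_sq ?_ (norm_nonneg _)
      refine (isLUB_norm_sq _).2 ?_
      rintro _ ⟨t, ⟨h0, h1⟩, rfl⟩
      exact (sqMean_mul_le hφ hφ1 f.2.1 h0 h1).trans (f.isLUB_norm_sq.1 ⟨t, ⟨h0, h1⟩, rfl⟩)

/-- The operator `M₁` of multiplication by the first coordinate `z`. -/
def M₁ : HardyBidisc →L[ℂ] HardyBidisc :=
  mulOp (fun p => p.1) differentiableOn_fst fun _ hp => (HardyAux.mem_bidisc.1 hp).1.le

/-- The operator `M₂` of multiplication by the second coordinate `w`. -/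
def M₂ : HardyBidisc →L[ℂ] HardyBidisc :=
  mulOp (fun p => p.2) differentiableOn_snd fun _ hp => (HardyAux.mem_bidisc.1 hp).2.le

/-- A quotient module of `H²(𝔻²)`: a closed subspace invariant under `M₁*` and `M₂*`. -/
def IsQuotientModule (Q : Submodule ℂ HardyBidisc) : Prop :=
  IsClosed (Q : Set HardyBidisc) ∧
    ∀ f ∈ Q, ContinuousLinearMap.adjoint M₁ f ∈ Q ∧ ContinuousLinearMap.adjoint M₂ f ∈ Q

/-- The compression `P_Q T|_Q` of an operator `T` to a closed subspace `Q`. -/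
def compression (Q : Submodule ℂ HardyBidisc) [CompleteSpace Q]
    (T : HardyBidisc →L[ℂ] HardyBidisc) : Q →L[ℂ] Q :=
  Q.orthogonalProjectionOnto ∘L T ∘L Q.subtypeL

/-- A quotient module `Q` of `H²(𝔻²)` is `φ`-doubly commuting if the compressions
`Q₁ = P_Q M₁|_Q` and `Q₂ = P_Q M₂|_Q` satisfy `Q₁ Q₂ Q₂* = Q₂* Q₁ Q₂`. -/
def IsPhiDoublyCommuting (Q : Submodule ℂ HardyBidisc) [CompleteSpace Q] : Prop :=
  IsQuotientModule Q ∧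
    compression Q M₁ ∘L compression Q M₂ ∘L ContinuousLinearMap.adjoint (compression Q M₂) =
      ContinuousLinearMap.adjoint (compression Q M₂) ∘L compression Q M₁ ∘L compression Q M₂

/-- The subspace `θ₁(z)θ₂(w)H²(𝔻²)` of `H²(𝔻²)`. -/
def productSubmodule (θ₁ θ₂ : ℂ → ℂ) : Submodule ℂ HardyBidisc where
  carrier := {f | ∃ g : HardyBidisc, ∀ p ∈ bidisc, f p = θ₁ p.1 * θ₂ p.2 * g p}
  zero_mem' := ⟨0, fun p _ => (mul_zero _).symm⟩
  add_mem' := by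
    rintro f f' ⟨g, hg⟩ ⟨g', hg'⟩
    refine ⟨g + g', fun p hp => ?_⟩
    change f p + f' p = θ₁ p.1 * θ₂ p.2 * (g p + g' p)
    rw [hg p hp, hg' p hp, mul_add]
  smul_mem' := by
    rintro c f ⟨g, hg⟩
    refine ⟨c • g, fun p hp => ?_⟩
    change c * f p = θ₁ p.1 * θ₂ p.2 * (c * g p)
    rw [hg p hp, mul_left_comm]

end HardyBidisc

/-- Inner functions on the unit disc: bounded holomorphic functions on `𝔻` whose radial limits
exist and are unimodular at almost every point of the unit circle. Values outside of `𝔻` are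
irrelevant. -/
structure IsInner (θ : ℂ → ℂ) : Prop where
  holo : DifferentiableOn ℂ θ (Metric.ball 0 1)
  bdd : ∃ C : ℝ, ∀ z ∈ Metric.ball (0 : ℂ) 1, ‖θ z‖ ≤ C
  radial : ∀ᵐ α : ℝ, ∃ ζ : ℂ, ‖ζ‖ = 1 ∧
    Tendsto (fun r : ℝ => θ (r * Complex.exp (α * Complex.I))) (𝓝[<] 1) (𝓝 ζ)

end

/-!
All operators act on `H²(𝔻²)`; write `T₁`, `T₂` for multiplication by `θ₁(z)` and `θ₂(w)`. These
are isometries, so the projection onto `𝒬` is `f ↦ f - T₁ T₂ T₂* T₁* f`, and taking adjoints turns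
the commutation relation into `P M₂ M₂* M₁* f = M₂* M₁* P M₂ f` for `f ∈ 𝒬`. Everything is then
read off from a few vectors of `𝒬`: those killed by `T₁*` and `M₂*` show that `θ₁` is constant or
linear, and those built from `k = 1 - conj (θ₂ 0) θ₂(w)`, which `T₂*` kills, show that `θ₂` is a
Möbius transformation, which vanishes at `0` unless `θ₁` is constant.
-/

lemma ofReal_mul_exp_mem_ball {r : ℝ} (h0 : 0 ≤ r) (h1 : r < 1) (α : ℝ) :
    (r * Complex.exp (α * Complex.I) : ℂ) ∈ Metric.ball (0 : ℂ) 1 := by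
  simpa [Complex.norm_exp_ofReal_mul_I, abs_of_nonneg h0] using h1

lemma continuous_comp_circle {g : ℂ → ℂ} (hg : ContinuousOn g (Metric.ball 0 1)) {r : ℝ}
    (h0 : 0 ≤ r) (h1 : r < 1) : Continuous fun x : ℝ => g (r * Complex.exp (x * Complex.I)) :=
  hg.comp_continuous (by fun_prop) (ofReal_mul_exp_mem_ball h0 h1)

lemma norm_le_integral_circle {g : ℂ → ℂ} (hg : DifferentiableOn ℂ g (Metric.ball 0 1)) {z : ℂ}
    {r : ℝ} (hz : ‖z‖ < r) (hr : r < 1) :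
    ‖g z‖ ≤ (2 * Real.pi)⁻¹ * ((1 - ‖z‖ / r)⁻¹ *
      ∫ x in Icc (0 : ℝ) (2 * Real.pi), ‖g (r * Complex.exp (x * Complex.I))‖) := by
  have hr0 : 0 < r := (norm_nonneg z).trans_lt hz
  have hπ : ‖(2 * Real.pi : ℂ)⁻¹‖ = (2 * Real.pi)⁻¹ := by simp [abs_of_pos Real.pi_pos]
  rw [HardyAux.cauchy1 hg hr hz, norm_mul, hπ, ← integral_const_mul]
  refine mul_le_mul_of_nonneg_left ?_ (by positivity)
  refine norm_integral_le_of_norm_le ?_ (Eventually.of_forall fun x => ?_)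
  · exact (continuous_const.mul (continuous_comp_circle hg.continuousOn hr0.le
      hr).norm).continuousOn.integrableOn_compact isCompact_Icc
  · have hquot : ‖z / (r * Complex.exp (x * Complex.I))‖ = ‖z‖ / r := by
      simp [Complex.norm_exp_ofReal_mul_I, abs_of_pos hr0]
    have hden : 1 - ‖z‖ / r ≤ ‖1 - z / (r * Complex.exp (x * Complex.I))‖ := by
      simpa only [hquot, norm_one] using norm_sub_norm_le 1 (z / (r * Complex.exp (x * Complex.I)))
    have hpos : 0 < 1 - ‖z‖ / r := sub_pos.2 ((div_lt_one hr0).2 hz)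
    rw [norm_mul, norm_inv]
    gcongr

namespace IsInner

variable {θ : ℂ → ℂ}

lemma tendsto_norm (h : IsInner θ) : ∀ᵐ α : ℝ,
    Tendsto (fun r : ℝ => ‖θ (r * Complex.exp (α * Complex.I))‖) (𝓝[<] 1) (𝓝 1) := by
  filter_upwards [h.radial] with α ⟨ζ, hζ, ht⟩
  exact hζ ▸ ht.norm

protected lemma one : IsInner fun _ => 1 where
  holo := differentiableOn_const 1
  bdd := ⟨1, fun _ _ => norm_one.le⟩
  radial := Eventually.of_forall fun _ => ⟨1, norm_one, tendsto_const_nhds⟩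

protected lemma id : IsInner fun z => z where
  holo := differentiableOn_id
  bdd := ⟨1, fun z hz => (mem_ball_zero_iff.1 hz).le⟩
  radial := Eventually.of_forall fun α =>
    ⟨Complex.exp (α * Complex.I), Complex.norm_exp_ofReal_mul_I α, by
      have hc : Continuous fun r : ℝ => (r * Complex.exp (α * Complex.I) : ℂ) := by fun_prop
      simpa using (hc.tendsto 1).mono_left (nhdsWithin_le_nhds (s := Iio 1))⟩

protected lemma pow (h : IsInner θ) (n : ℕ) : IsInner (θ ^ n) where
  holo := h.holo.pow n
  bdd := by
    obtain ⟨C, hC⟩ := h.bdd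
    exact ⟨C ^ n, fun z hz => by
      simpa only [Pi.pow_apply, norm_pow] using pow_le_pow_left₀ (norm_nonneg _) (hC z hz) n⟩
  radial := by
    filter_upwards [h.radial] with α ⟨ζ, hζ, ht⟩
    exact ⟨ζ ^ n, by rw [norm_pow, hζ, one_pow], ht.pow n⟩

lemma tendsto_integral_circle (h : IsInner θ) :
    Tendsto (fun r : ℝ => ∫ x in Icc (0 : ℝ) (2 * Real.pi), ‖θ (r * Complex.exp (x * Complex.I))‖)
      (𝓝[<] 1) (𝓝 (2 * Real.pi)) := by
  obtain ⟨C, hC⟩ := h.bdd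
  have hmass : ∫ _ in Icc (0 : ℝ) (2 * Real.pi), (1 : ℝ) = 2 * Real.pi := by
    simp [Real.pi_pos.le]
  nth_rewrite 2 [← hmass]
  refine tendsto_integral_filter_of_dominated_convergence (fun _ => C) ?_ ?_ ?_
    (ae_restrict_of_ae h.tendsto_norm)
  · filter_upwards [Ioo_mem_nhdsLT zero_lt_one] with r hr
    exact (continuous_comp_circle h.holo.continuousOn hr.1.le hr.2).norm.aestronglyMeasurable
  · filter_upwards [Ioo_mem_nhdsLT zero_lt_one] with r hr
    exact Eventually.of_forall fun x => by
      simpa only [norm_norm] using hC _ (ofReal_mul_exp_mem_ball hr.1.le hr.2 x)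
  · exact integrable_const C

lemma norm_le_inv_one_sub (h : IsInner θ) {z : ℂ} (hz : ‖z‖ < 1) : ‖θ z‖ ≤ (1 - ‖z‖)⁻¹ := by
  have hker : Tendsto (fun r : ℝ => (1 - ‖z‖ / r)⁻¹) (𝓝[<] 1) (𝓝 (1 - ‖z‖)⁻¹) := by
    have : ContinuousAt (fun r : ℝ => (1 - ‖z‖ / r)⁻¹) 1 := by
      refine ContinuousAt.inv₀ (by fun_prop (disch := norm_num)) ?_
      rw [div_one]
      exact (sub_pos.2 hz).ne'
    simpa using this.tendsto.mono_left (nhdsWithin_le_nhds (s := Iio 1))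
  have hlim := (hker.mul h.tendsto_integral_circle).const_mul (2 * Real.pi)⁻¹
  rw [mul_comm (1 - ‖z‖)⁻¹, inv_mul_cancel_left₀ (by positivity)] at hlim
  refine ge_of_tendsto hlim ?_
  filter_upwards [Ioo_mem_nhdsLT hz] with r hr
  exact norm_le_integral_circle h.holo hr.1 hr.2

/- The bound `(1 - ‖z‖)⁻¹` does not depend on the inner function, so it also bounds all powers. -/
lemma norm_le_one (h : IsInner θ) {z : ℂ} (hz : ‖z‖ < 1) : ‖θ z‖ ≤ 1 := by
  by_contra! hlt
  obtain ⟨n, hn⟩ := pow_unbounded_of_one_lt (1 - ‖z‖)⁻¹ hlt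
  refine hn.not_ge ?_
  simpa only [Pi.pow_apply, norm_pow] using (h.pow n).norm_le_inv_one_sub hz

lemma eq_const_or_norm_lt_one (h : IsInner θ) :
    (∃ c : ℂ, ∀ z ∈ Metric.ball (0 : ℂ) 1, θ z = c) ∨ ‖θ 0‖ < 1 := by
  refine or_iff_not_imp_right.2 fun h0 => ⟨θ 0, ?_⟩
  have hmax : IsMaxOn (norm ∘ θ) (Metric.ball 0 1) 0 := fun z hz =>
    (h.norm_le_one (mem_ball_zero_iff.1 hz)).trans (not_lt.1 h0)
  exact Complex.eqOn_of_isPreconnected_of_isMaxOn_norm (convex_ball 0 1).isPreconnected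
    Metric.isOpen_ball h.holo (Metric.mem_ball_self one_pos) hmax

end IsInner

lemma zero_mk_mem_bidisc {p : ℂ × ℂ} (hp : p ∈ bidisc) : (0, p.2) ∈ bidisc :=
  ⟨Metric.mem_ball_self one_pos, hp.2⟩

lemma mk_zero_mem_bidisc {p : ℂ × ℂ} (hp : p ∈ bidisc) : (p.1, 0) ∈ bidisc :=
  ⟨hp.1, Metric.mem_ball_self one_pos⟩

lemma continuous_torusPt_prod : Continuous fun x : ℝ × (ℝ × ℝ) => torusPt x.1 x.2 := by
  unfold torusPt
  fun_prop

lemma sqMean_congr {f g : ℂ × ℂ → ℂ} (h : EqOn f g bidisc) {t : ℝ} (h0 : 0 ≤ t) (h1 : t < 1) :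
    sqMean t f = sqMean t g := by
  simp only [sqMean, h (HardyAux.torusPt_mem h0 h1 _)]

lemma tendsto_sqMean_mul {φ G : ℂ × ℂ → ℂ} (hφ : DifferentiableOn ℂ φ bidisc)
    (hφ1 : ∀ p ∈ bidisc, ‖φ p‖ ≤ 1)
    (hlim : ∀ᵐ p : ℝ × ℝ, Tendsto (fun t => ‖φ (torusPt t p)‖) (𝓝[<] 1) (𝓝 1))
    (hG : Continuous G) :
    Tendsto (fun t => sqMean t fun p => φ p * G p) (𝓝[<] 1) (𝓝 (sqMean 1 G)) := by
  have hGt : Continuous fun x : ℝ × (ℝ × ℝ) => G (torusPt x.1 x.2) :=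
    hG.comp continuous_torusPt_prod
  obtain ⟨B, hB⟩ : ∃ B, ∀ x ∈ Icc (0 : ℝ) 1 ×ˢ argBox, ‖G (torusPt x.1 x.2)‖ ≤ B :=
    (isCompact_Icc.prod HardyAux.isCompact_box).exists_bound_of_continuousOn hGt.continuousOn
  refine Tendsto.const_mul _
    (tendsto_integral_filter_of_dominated_convergence (fun _ => B ^ 2) ?_ ?_ ?_ ?_)
  · filter_upwards [Ioo_mem_nhdsLT zero_lt_one] with t ht
    exact (((HardyAux.continuous_comp_torusPt hφ ht.1.le ht.2).mul
      (hGt.comp (.prodMk_right t))).norm.pow 2).aestronglyMeasurable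
  · filter_upwards [Ioo_mem_nhdsLT zero_lt_one] with t ht
    filter_upwards [ae_restrict_mem HardyAux.isCompact_box.measurableSet] with p hp
    rw [norm_pow, norm_norm, norm_mul]
    gcongr
    have hφt := hφ1 _ (HardyAux.torusPt_mem ht.1.le ht.2 p)
    exact (mul_le_of_le_one_left (norm_nonneg _) hφt).trans (hB (t, p) ⟨⟨ht.1.le, ht.2.le⟩, hp⟩)
  · exact integrable_const (B ^ 2)
  · filter_upwards [ae_restrict_of_ae hlim] with p hp
    have hGp : Tendsto (fun t : ℝ => ‖G (torusPt t p)‖) (𝓝[<] 1) (𝓝 ‖G (torusPt 1 p)‖) :=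
      ((hGt.comp (.prodMk_left p)).norm.tendsto (1 : ℝ)).mono_left nhdsWithin_le_nhds
    simpa only [norm_mul, one_mul] using (hp.mul hGp).pow 2

namespace HardyBidisc

@[simp] lemma add_apply (f g : HardyBidisc) (p : ℂ × ℂ) : (f + g) p = f p + g p := rfl

@[simp] lemma sub_apply (f g : HardyBidisc) (p : ℂ × ℂ) : (f - g) p = f p - g p := rfl

@[simp] lemma smul_apply (c : ℂ) (f : HardyBidisc) (p : ℂ × ℂ) : (c • f) p = c * f p := rfl

lemma mulOp_apply {φ : ℂ × ℂ → ℂ} (hφ : DifferentiableOn ℂ φ bidisc)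
    (hφ1 : ∀ p ∈ bidisc, ‖φ p‖ ≤ 1) (f : HardyBidisc) (p : ℂ × ℂ) :
    mulOp φ hφ hφ1 f p = φ p * f p := rfl

/-- The orthonormal basis of `H²(𝔻²)` formed by the monomials `z^m w^n`. -/
noncomputable def monomialBasis : HilbertBasis (ℕ × ℕ) ℂ HardyBidisc := .ofRepr coeffsEquiv

lemma inner_monomialBasis (k : ℕ × ℕ) (f : HardyBidisc) :
    inner ℂ (monomialBasis k) f = coeff f k := monomialBasis.repr_apply_apply f k |>.symm

lemma monomialBasis_apply (k : ℕ × ℕ) {p : ℂ × ℂ} (hp : p ∈ bidisc) :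
    monomialBasis k p = HardyAux.mono k p := by
  have hcoeff (j : ℕ × ℕ) : coeff (monomialBasis k) j = if j = k then 1 else 0 := by
    rw [← inner_monomialBasis]
    exact orthonormal_iff_ite.1 monomialBasis.orthonormal j k
  have hsum := (hasSum (monomialBasis k) hp).unique
    (hasSum_single k fun j hj => by rw [hcoeff, if_neg hj, zero_mul])
  rwa [hcoeff, if_pos rfl, one_mul] at hsum

lemma exists_continuous_of_mem_span {f : HardyBidisc}
    (hf : f ∈ Submodule.span ℂ (range monomialBasis)) :
    ∃ G : ℂ × ℂ → ℂ, Continuous G ∧ EqOn f G bidisc := by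
  induction hf using Submodule.span_induction with
  | mem _ hx =>
    obtain ⟨k, rfl⟩ := hx
    exact ⟨HardyAux.mono k, by unfold HardyAux.mono; fun_prop, fun p => monomialBasis_apply k⟩
  | zero => exact ⟨0, continuous_zero, fun _ _ => rfl⟩
  | add f g _ _ hf hg =>
    obtain ⟨F, hFc, hF⟩ := hf
    obtain ⟨G, hGc, hG⟩ := hg
    exact ⟨F + G, hFc.add hGc, fun p hp => by simp [hF hp, hG hp]⟩
  | smul c f _ hf =>
    obtain ⟨F, hFc, hF⟩ := hf
    exact ⟨c • F, hFc.const_smul c, fun p hp => by simp [hF hp]⟩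

lemma hasSum_norm_coeff_sq (f : HardyBidisc) : HasSum (fun k => ‖coeff f k‖ ^ 2) (‖f‖ ^ 2) := by
  simpa [norm_coeffs] using! lp.hasSum_norm (p := 2) (by norm_num) (coeffs f)

lemma tendsto_sqMean (f : HardyBidisc) :
    Tendsto (fun t => sqMean t f) (𝓝[<] 1) (𝓝 (‖f‖ ^ 2)) := by
  rw [← f.hasSum_norm_coeff_sq.tsum_eq]
  refine Tendsto.congr' (f₁ := fun t : ℝ => ∑' k, ‖coeff f k * (t : ℂ) ^ (k.1 + k.2)‖ ^ 2) ?_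
    (tendsto_tsum_of_dominated_convergence f.summable_sq (fun k => ?_) ?_)
  · filter_upwards [Ioo_mem_nhdsLT zero_lt_one] with t ht
    exact (f.sqMean_eq ht.1.le ht.2).tsum_eq
  · have hc : Continuous fun t : ℝ => ‖coeff f k * (t : ℂ) ^ (k.1 + k.2)‖ ^ 2 := by fun_prop
    simpa using (hc.tendsto 1).mono_left (nhdsWithin_le_nhds (s := Iio 1))
  · filter_upwards [Ioo_mem_nhdsLT zero_lt_one] with t ht k
    rw [norm_pow, norm_norm, norm_mul, norm_pow, Complex.norm_of_nonneg ht.1.le]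
    exact pow_le_pow_left₀ (mul_nonneg (norm_nonneg _) (pow_nonneg ht.1.le _))
      (mul_le_of_le_one_right (norm_nonneg _) (pow_le_one₀ ht.1.le ht.2.le)) 2

lemma norm_sq_eq_sqMean_one {φ G : ℂ × ℂ → ℂ} {f : HardyBidisc} (hφ : DifferentiableOn ℂ φ bidisc)
    (hφ1 : ∀ p ∈ bidisc, ‖φ p‖ ≤ 1)
    (hlim : ∀ᵐ p : ℝ × ℝ, Tendsto (fun t => ‖φ (torusPt t p)‖) (𝓝[<] 1) (𝓝 1))
    (hG : Continuous G) (hf : EqOn f (fun p => φ p * G p) bidisc) : ‖f‖ ^ 2 = sqMean 1 G := by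
  refine tendsto_nhds_unique f.tendsto_sqMean
    ((tendsto_sqMean_mul hφ hφ1 hlim hG).congr' ?_)
  filter_upwards [Ioo_mem_nhdsLT zero_lt_one] with t ht
  exact (sqMean_congr hf ht.1.le ht.2).symm

/- The monomials span a dense subspace, and on it both norms are the mean square over the torus. -/
lemma norm_mulOp {φ : ℂ × ℂ → ℂ} (hφ : DifferentiableOn ℂ φ bidisc)
    (hφ1 : ∀ p ∈ bidisc, ‖φ p‖ ≤ 1)
    (hlim : ∀ᵐ p : ℝ × ℝ, Tendsto (fun t => ‖φ (torusPt t p)‖) (𝓝[<] 1) (𝓝 1))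
    (f : HardyBidisc) : ‖mulOp φ hφ hφ1 f‖ = ‖f‖ := by
  have hdense : Dense (Submodule.span ℂ (range monomialBasis) : Set HardyBidisc) :=
    Submodule.dense_iff_topologicalClosure_eq_top.2 monomialBasis.dense_span
  refine congrFun (Continuous.ext_on hdense (mulOp φ hφ hφ1).continuous.norm continuous_norm
    fun g hg => ?_) f
  obtain ⟨G, hGc, hG⟩ := exists_continuous_of_mem_span hg
  have hφg := norm_sq_eq_sqMean_one (f := mulOp φ hφ hφ1 g) hφ hφ1 hlim hGc fun p hp => by
    simp only [mulOp_apply, hG hp]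
  have hg : ‖g‖ ^ 2 = sqMean 1 G :=
    norm_sq_eq_sqMean_one (φ := fun _ => 1) (differentiableOn_const 1) (fun _ _ => norm_one.le)
      (Eventually.of_forall fun _ => by simp) hGc fun p hp => by simp only [one_mul, hG hp]
  exact (sq_eq_sq₀ (norm_nonneg _) (norm_nonneg _)).1 (hφg.trans hg.symm)

end HardyBidisc

namespace IsInner

open HardyBidisc
open scoped InnerProduct

variable {θ : ℂ → ℂ}

/-- The operator of multiplication by `θ(z)`. -/
noncomputable def mulFst (h : IsInner θ) : HardyBidisc →L[ℂ] HardyBidisc :=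
  mulOp (fun p => θ p.1) (h.holo.comp differentiableOn_fst fun _ hp => hp.1) fun _ hp =>
    h.norm_le_one (HardyAux.mem_bidisc.1 hp).1

/-- The operator of multiplication by `θ(w)`. -/
noncomputable def mulSnd (h : IsInner θ) : HardyBidisc →L[ℂ] HardyBidisc :=
  mulOp (fun p => θ p.2) (h.holo.comp differentiableOn_snd fun _ hp => hp.2) fun _ hp =>
    h.norm_le_one (HardyAux.mem_bidisc.1 hp).2

@[simp] lemma mulFst_apply (h : IsInner θ) (f : HardyBidisc) (p : ℂ × ℂ) :
    h.mulFst f p = θ p.1 * f p := rfl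

@[simp] lemma mulSnd_apply (h : IsInner θ) (f : HardyBidisc) (p : ℂ × ℂ) :
    h.mulSnd f p = θ p.2 * f p := rfl

lemma norm_mulFst (h : IsInner θ) (f : HardyBidisc) : ‖h.mulFst f‖ = ‖f‖ :=
  norm_mulOp (φ := fun p => θ p.1) _ _ (Measure.quasiMeasurePreserving_fst.ae h.tendsto_norm) f

lemma norm_mulSnd (h : IsInner θ) (f : HardyBidisc) : ‖h.mulSnd f‖ = ‖f‖ :=
  norm_mulOp (φ := fun p => θ p.2) _ _ (Measure.quasiMeasurePreserving_snd.ae h.tendsto_norm) f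

lemma adjoint_mulFst_mulFst (h : IsInner θ) (f : HardyBidisc) : (h.mulFst†) (h.mulFst f) = f :=
  DFunLike.congr_fun
    ((ContinuousLinearMap.norm_map_iff_adjoint_comp_self h.mulFst).1 h.norm_mulFst) f

lemma adjoint_mulSnd_mulSnd (h : IsInner θ) (f : HardyBidisc) : (h.mulSnd†) (h.mulSnd f) = f :=
  DFunLike.congr_fun
    ((ContinuousLinearMap.norm_map_iff_adjoint_comp_self h.mulSnd).1 h.norm_mulSnd) f

lemma mulFst_injective (h : IsInner θ) : Function.Injective h.mulFst :=
  Function.LeftInverse.injective h.adjoint_mulFst_mulFst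

lemma mulSnd_injective (h : IsInner θ) : Function.Injective h.mulSnd :=
  Function.LeftInverse.injective h.adjoint_mulSnd_mulSnd

end IsInner

namespace HardyBidisc

open scoped InnerProduct

@[simp] lemma M₁_apply (f : HardyBidisc) (p : ℂ × ℂ) : M₁ f p = p.1 * f p := rfl

@[simp] lemma M₂_apply (f : HardyBidisc) (p : ℂ × ℂ) : M₂ f p = p.2 * f p := rfl

@[simp] lemma adjoint_M₁_M₁ (f : HardyBidisc) : (M₁†) (M₁ f) = f :=
  IsInner.id.adjoint_mulFst_mulFst f

@[simp] lemma adjoint_M₂_M₂ (f : HardyBidisc) : (M₂†) (M₂ f) = f :=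
  IsInner.id.adjoint_mulSnd_mulSnd f

section AdjointMonomial

variable {φ : ℂ × ℂ → ℂ} {hφ : DifferentiableOn ℂ φ bidisc} {hφ1 : ∀ p ∈ bidisc, ‖φ p‖ ≤ 1}
  {e : ℕ × ℕ → ℕ × ℕ}

lemma coeff_adjoint_mulOp (he : ∀ k p, φ p * HardyAux.mono k p = HardyAux.mono (e k) p)
    (f : HardyBidisc) (k : ℕ × ℕ) : coeff (((mulOp φ hφ hφ1)†) f) k = coeff f (e k) := by
  have hbasis : mulOp φ hφ hφ1 (monomialBasis k) = monomialBasis (e k) := ext_bidisc fun p hp => by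
    rw [mulOp_apply, monomialBasis_apply _ hp, monomialBasis_apply _ hp, he]
  rw [← inner_monomialBasis, ContinuousLinearMap.adjoint_inner_right, hbasis, inner_monomialBasis]

lemma mulOp_adjoint_mulOp_apply (hinj : Function.Injective e)
    (he : ∀ k p, φ p * HardyAux.mono k p = HardyAux.mono (e k) p) (f : HardyBidisc) {p p₀ : ℂ × ℂ}
    (hp : p ∈ bidisc) (hp₀ : p₀ ∈ bidisc) (hzero : ∀ k, HardyAux.mono (e k) p₀ = 0)
    (heq : ∀ k ∉ range e, HardyAux.mono k p = HardyAux.mono k p₀) :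
    mulOp φ hφ hφ1 (((mulOp φ hφ hφ1)†) f) p = f p - f p₀ := by
  have hdiff := (f.hasSum hp).sub (f.hasSum hp₀)
  refine HasSum.unique ?_ ((hinj.hasSum_iff fun k hk => ?_).2 hdiff)
  · convert! ((((mulOp φ hφ hφ1)†) f).hasSum hp).mul_left (φ p) using 2 with k
    have h0 := hzero k
    have h1 := he k p
    simp only [HardyAux.mono] at h0 h1
    rw [coeff_adjoint_mulOp he, Function.comp_apply, h0, mul_zero, sub_zero, ← h1, mul_left_comm]
  · rw [← mul_sub]
    exact mul_eq_zero_of_right _ (sub_eq_zero.2 (heq k hk))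

end AdjointMonomial

lemma M₁_adjoint_M₁_apply (f : HardyBidisc) {p : ℂ × ℂ} (hp : p ∈ bidisc) :
    M₁ ((M₁†) f) p = f p - f (0, p.2) := by
  refine mulOp_adjoint_mulOp_apply (e := fun k => (k.1 + 1, k.2)) (fun j k h => ?_)
    (fun k q => ?_) f hp (zero_mk_mem_bidisc hp) (fun k => ?_) fun k hk => ?_
  · simpa [Prod.ext_iff] using h
  · simp only [HardyAux.mono]; ring
  · simp [HardyAux.mono]
  · obtain ⟨_ | m, n⟩ := k
    · simp [HardyAux.mono]
    · exact absurd ⟨(m, n), rfl⟩ hk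

lemma M₂_adjoint_M₂_apply (f : HardyBidisc) {p : ℂ × ℂ} (hp : p ∈ bidisc) :
    M₂ ((M₂†) f) p = f p - f (p.1, 0) := by
  refine mulOp_adjoint_mulOp_apply (e := fun k => (k.1, k.2 + 1)) (fun j k h => ?_)
    (fun k q => ?_) f hp (mk_zero_mem_bidisc hp) (fun k => ?_) fun k hk => ?_
  · simpa [Prod.ext_iff] using h
  · simp only [HardyAux.mono]; ring
  · simp [HardyAux.mono]
  · obtain ⟨m, _ | n⟩ := k
    · simp [HardyAux.mono]
    · exact absurd ⟨(m, n), rfl⟩ hk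

lemma adjoint_M₁_eq_zero_iff {f : HardyBidisc} :
    (M₁†) f = 0 ↔ ∀ p ∈ bidisc, f p = f (0, p.2) := by
  rw [← map_eq_zero_iff M₁ IsInner.id.mulFst_injective]
  constructor
  · intro h p hp
    rw [← sub_eq_zero, ← M₁_adjoint_M₁_apply f hp, h]
    rfl
  · exact fun h => ext_bidisc fun p hp => by
      rw [M₁_adjoint_M₁_apply f hp, ← h p hp, sub_self]
      rfl

lemma adjoint_M₂_eq_zero_iff {f : HardyBidisc} :
    (M₂†) f = 0 ↔ ∀ p ∈ bidisc, f p = f (p.1, 0) := by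
  rw [← map_eq_zero_iff M₂ IsInner.id.mulSnd_injective]
  constructor
  · intro h p hp
    rw [← sub_eq_zero, ← M₂_adjoint_M₂_apply f hp, h]
    rfl
  · exact fun h => ext_bidisc fun p hp => by
      rw [M₂_adjoint_M₂_apply f hp, ← h p hp, sub_self]
      rfl

/-- The constant function `1`. -/
noncomputable def one : HardyBidisc := monomialBasis (0, 0)

lemma one_apply {p : ℂ × ℂ} (hp : p ∈ bidisc) : one p = 1 := by
  simp [one, monomialBasis_apply _ hp, HardyAux.mono]

lemma zero_mem_bidisc : (0, 0) ∈ bidisc := by simp [HardyAux.mem_bidisc]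

lemma inner_one (f : HardyBidisc) : inner ℂ one f = f (0, 0) := by
  have hf := (f.hasSum zero_mem_bidisc).unique (hasSum_single (0, 0) fun k hk => ?_)
  · simpa [one, inner_monomialBasis] using hf.symm
  · rcases not_and_or.1 (mt Prod.ext_iff.2 hk) with h | h <;> simp_all

lemma eq_smul_one {f : HardyBidisc} (h₁ : (M₁†) f = 0) (h₂ : (M₂†) f = 0) :
    f = f (0, 0) • one := ext_bidisc fun p hp => by
  rw [smul_apply, one_apply hp, mul_one, adjoint_M₁_eq_zero_iff.1 h₁ p hp,
    adjoint_M₂_eq_zero_iff.1 h₂ _ (zero_mk_mem_bidisc hp)]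

lemma adjoint_M₁_one : (M₁†) one = 0 :=
  adjoint_M₁_eq_zero_iff.2 fun _ hp =>
    (one_apply hp).trans (one_apply (zero_mk_mem_bidisc hp)).symm

lemma adjoint_M₂_one : (M₂†) one = 0 :=
  adjoint_M₂_eq_zero_iff.2 fun _ hp =>
    (one_apply hp).trans (one_apply (mk_zero_mem_bidisc hp)).symm

lemma adjoint_comm {A B : HardyBidisc →L[ℂ] HardyBidisc} (h : ∀ f, A (B f) = B (A f))
    (f : HardyBidisc) : (A†) ((B†) f) = (B†) ((A†) f) :=
  ext_inner_left ℂ fun g => by simp only [ContinuousLinearMap.adjoint_inner_right, h]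

lemma adjoint_comm_of_adjoint_comm {A B : HardyBidisc →L[ℂ] HardyBidisc}
    (h : ∀ f, (A†) (B f) = B ((A†) f)) (f : HardyBidisc) : (B†) (A f) = A ((B†) f) :=
  ext_inner_left ℂ fun g => by
    rw [ContinuousLinearMap.adjoint_inner_right, ← ContinuousLinearMap.adjoint_inner_left, h,
      ← ContinuousLinearMap.adjoint_inner_right, ContinuousLinearMap.adjoint_inner_left]

lemma M₁_M₂ (f : HardyBidisc) : M₁ (M₂ f) = M₂ (M₁ f) :=
  ext_bidisc fun _ _ => mul_left_comm _ _ _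

lemma adjoint_M₁_adjoint_M₂ (f : HardyBidisc) : (M₁†) ((M₂†) f) = (M₂†) ((M₁†) f) :=
  adjoint_comm M₁_M₂ f

end HardyBidisc

namespace IsInner

open HardyBidisc
open scoped InnerProduct

variable {θ ψ : ℂ → ℂ}

lemma mulFst_M₁ (h : IsInner θ) (f : HardyBidisc) : h.mulFst (M₁ f) = M₁ (h.mulFst f) :=
  ext_bidisc fun _ _ => mul_left_comm _ _ _

lemma mulFst_M₂ (h : IsInner θ) (f : HardyBidisc) : h.mulFst (M₂ f) = M₂ (h.mulFst f) :=
  ext_bidisc fun _ _ => mul_left_comm _ _ _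

lemma mulSnd_M₁ (h : IsInner θ) (f : HardyBidisc) : h.mulSnd (M₁ f) = M₁ (h.mulSnd f) :=
  ext_bidisc fun _ _ => mul_left_comm _ _ _

lemma mulSnd_M₂ (h : IsInner θ) (f : HardyBidisc) : h.mulSnd (M₂ f) = M₂ (h.mulSnd f) :=
  ext_bidisc fun _ _ => mul_left_comm _ _ _

lemma adjoint_M₂_mulFst (h : IsInner θ) (f : HardyBidisc) :
    (M₂†) (h.mulFst f) = h.mulFst ((M₂†) f) := by
  refine IsInner.id.mulSnd_injective (ext_bidisc fun p hp => ?_)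
  calc M₂ ((M₂†) (h.mulFst f)) p = θ p.1 * (f p - f (p.1, 0)) := by
        rw [M₂_adjoint_M₂_apply _ hp, mulFst_apply, mulFst_apply, mul_sub]
    _ = h.mulFst (M₂ ((M₂†) f)) p := by rw [mulFst_apply, M₂_adjoint_M₂_apply _ hp]
    _ = M₂ (h.mulFst ((M₂†) f)) p := congrArg (· p) (h.mulFst_M₂ _)

lemma adjoint_M₁_mulSnd (h : IsInner θ) (f : HardyBidisc) :
    (M₁†) (h.mulSnd f) = h.mulSnd ((M₁†) f) := by
  refine IsInner.id.mulFst_injective (ext_bidisc fun p hp => ?_)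
  calc M₁ ((M₁†) (h.mulSnd f)) p = θ p.2 * (f p - f (0, p.2)) := by
        rw [M₁_adjoint_M₁_apply _ hp, mulSnd_apply, mulSnd_apply, mul_sub]
    _ = h.mulSnd (M₁ ((M₁†) f)) p := by rw [mulSnd_apply, M₁_adjoint_M₁_apply _ hp]
    _ = M₁ (h.mulSnd ((M₁†) f)) p := congrArg (· p) (h.mulSnd_M₁ _)

lemma adjoint_mulFst_M₂ (h : IsInner θ) (f : HardyBidisc) :
    (h.mulFst†) (M₂ f) = M₂ ((h.mulFst†) f) :=
  adjoint_comm_of_adjoint_comm h.adjoint_M₂_mulFst f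

lemma adjoint_mulSnd_M₁ (h : IsInner θ) (f : HardyBidisc) :
    (h.mulSnd†) (M₁ f) = M₁ ((h.mulSnd†) f) :=
  adjoint_comm_of_adjoint_comm h.adjoint_M₁_mulSnd f

lemma adjoint_mulFst_one (h : IsInner θ) : (h.mulFst†) one = conj (θ 0) • one := by
  refine ext_inner_right ℂ fun g => ?_
  rw [ContinuousLinearMap.adjoint_inner_left, inner_smul_left, inner_one, inner_one,
    Complex.conj_conj, mulFst_apply]

lemma adjoint_mulSnd_one (h : IsInner θ) : (h.mulSnd†) one = conj (θ 0) • one := by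
  refine ext_inner_right ℂ fun g => ?_
  rw [ContinuousLinearMap.adjoint_inner_left, inner_smul_left, inner_one, inner_one,
    Complex.conj_conj, mulSnd_apply]

lemma norm_eq_one_of_eq_mul (h : IsInner θ) (h' : IsInner ψ) {c : ℂ}
    (hc : ∀ z ∈ Metric.ball (0 : ℂ) 1, θ z = c * ψ z) : ‖c‖ = 1 := by
  have hone : one ≠ 0 := monomialBasis.orthonormal.ne_zero (0, 0)
  have hmul : h.mulFst one = c • h'.mulFst one := ext_bidisc fun p hp => by
    rw [smul_apply, mulFst_apply, mulFst_apply, hc _ hp.1, mul_assoc]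
  have hnorm := congrArg norm hmul
  rw [norm_smul, norm_mulFst, norm_mulFst] at hnorm
  exact (right_eq_mul₀ (norm_ne_zero_iff.2 hone)).1 hnorm

lemma ne_zero_of_eq_const (h : IsInner θ) {c : ℂ}
    (hc : ∀ z ∈ Metric.ball (0 : ℂ) 1, θ z = c) : c ≠ 0 := by
  have hnorm : ‖c‖ = 1 := h.norm_eq_one_of_eq_mul .one fun z hz => by rw [hc z hz, mul_one]
  exact norm_ne_zero_iff.1 (hnorm ▸ one_ne_zero)

end IsInner

namespace HardyBidisc

open scoped InnerProduct

lemma adjoint_M₁_M₂ (f : HardyBidisc) : (M₁†) (M₂ f) = M₂ ((M₁†) f) :=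
  IsInner.id.adjoint_M₁_mulSnd f

section Compression

variable {Q : Submodule ℂ HardyBidisc} [CompleteSpace Q]

lemma coe_compression (T : HardyBidisc →L[ℂ] HardyBidisc) (f : Q) :
    (compression Q T f : HardyBidisc) = Q.starProjection (T f) := rfl

lemma adjoint_compression (T : HardyBidisc →L[ℂ] HardyBidisc) :
    (compression Q T)† = compression Q (T†) := by
  simp only [compression, ContinuousLinearMap.adjoint_comp, Submodule.adjoint_subtypeL,
    Submodule.adjoint_orthogonalProjectionOnto, ContinuousLinearMap.comp_assoc]

lemma coe_adjoint_compression {T : HardyBidisc →L[ℂ] HardyBidisc} (hT : ∀ f ∈ Q, (T†) f ∈ Q)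
    (f : Q) : (((compression Q T)†) f : HardyBidisc) = (T†) f := by
  rw [adjoint_compression, coe_compression, Submodule.starProjection_eq_self_iff]
  exact hT f f.2

/- The adjoint of the defining relation, which involves only one projection on either side. -/
lemma isPhiDoublyCommuting_iff :
    IsPhiDoublyCommuting Q ↔ IsQuotientModule Q ∧ ∀ f ∈ Q,
      Q.starProjection (M₂ ((M₂†) ((M₁†) f))) = (M₂†) ((M₁†) (Q.starProjection (M₂ f))) := by
  refine and_congr_right fun hQ => ?_
  have h₁ := coe_adjoint_compression (T := M₁) fun f hf => (hQ.2 f hf).1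
  have h₂ := coe_adjoint_compression (T := M₂) fun f hf => (hQ.2 f hf).2
  rw [← ContinuousLinearMap.adjoint.injective.eq_iff]
  simp only [ContinuousLinearMap.adjoint_comp, ContinuousLinearMap.adjoint_adjoint,
    ContinuousLinearMap.ext_iff, ContinuousLinearMap.comp_apply, Subtype.ext_iff, Subtype.forall,
    coe_compression, h₁, h₂]

lemma IsQuotientModule.isPhiDoublyCommuting_of_adjoint_eq_zero (hQ : IsQuotientModule Q)
    (h : ∀ f ∈ Q, (M₂†) ((M₁†) f) = 0) : IsPhiDoublyCommuting Q :=
  isPhiDoublyCommuting_iff.2 ⟨hQ, fun f hf => by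
    rw [h f hf, h _ (Q.starProjection_apply_mem _), map_zero, map_zero]⟩

lemma IsQuotientModule.isPhiDoublyCommuting_of_adjoint_M₂_eq_smul (hQ : IsQuotientModule Q)
    {c : ℂ} (h : ∀ f ∈ Q, (M₂†) f = c • f) : IsPhiDoublyCommuting Q := by
  have hproj : ∀ f ∈ Q, Q.starProjection (M₂ f) = conj c • f := fun f hf =>
    Submodule.eq_starProjection_of_mem_orthogonal (Q.smul_mem _ hf) fun g hg => by
      rw [inner_sub_right, ← ContinuousLinearMap.adjoint_inner_left, h g hg, inner_smul_left,
        inner_smul_right, sub_self]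
  refine isPhiDoublyCommuting_iff.2 ⟨hQ, fun f hf => ?_⟩
  have hf₁ := (hQ.2 f hf).1
  rw [h _ hf₁, map_smul, map_smul, hproj f hf, hproj _ hf₁, map_smul, map_smul, h _ hf₁,
    smul_comm]

end Compression

lemma isQuotientModule_orthogonal {S : Submodule ℂ HardyBidisc} (h₁ : ∀ f ∈ S, M₁ f ∈ S)
    (h₂ : ∀ f ∈ S, M₂ f ∈ S) : IsQuotientModule Sᗮ := by
  refine ⟨S.isClosed_orthogonal, fun f hf => ⟨fun g hg => ?_, fun g hg => ?_⟩⟩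
  · rw [ContinuousLinearMap.adjoint_inner_right]
    exact hf _ (h₁ g hg)
  · rw [ContinuousLinearMap.adjoint_inner_right]
    exact hf _ (h₂ g hg)

lemma isQuotientModule_productSubmodule (θ₁ θ₂ : ℂ → ℂ) :
    IsQuotientModule (productSubmodule θ₁ θ₂)ᗮ :=
  isQuotientModule_orthogonal
    (fun _ ⟨g, hg⟩ => ⟨M₁ g, fun p hp => by rw [M₁_apply, M₁_apply, hg p hp, mul_left_comm]⟩)
    (fun _ ⟨g, hg⟩ => ⟨M₂ g, fun p hp => by rw [M₂_apply, M₂_apply, hg p hp, mul_left_comm]⟩)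

section Inner

variable {θ₁ θ₂ : ℂ → ℂ} (h₁ : IsInner θ₁) (h₂ : IsInner θ₂)
include h₁ h₂

lemma mem_productSubmodule_iff {f : HardyBidisc} :
    f ∈ productSubmodule θ₁ θ₂ ↔ ∃ g, h₁.mulFst (h₂.mulSnd g) = f := by
  refine exists_congr fun g => ⟨fun h => ext_bidisc fun p hp => ?_, fun h p _ => ?_⟩
  · rw [h p hp, IsInner.mulFst_apply, IsInner.mulSnd_apply, mul_assoc]
  · rw [← h, IsInner.mulFst_apply, IsInner.mulSnd_apply, mul_assoc]

lemma mem_productSubmodule_orthogonal_iff {f : HardyBidisc} :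
    f ∈ (productSubmodule θ₁ θ₂)ᗮ ↔ (h₂.mulSnd†) ((h₁.mulFst†) f) = 0 := by
  simp only [Submodule.mem_orthogonal, mem_productSubmodule_iff h₁ h₂, forall_exists_index,
    forall_apply_eq_imp_iff, ← ContinuousLinearMap.adjoint_inner_right]
  exact ⟨fun h => inner_self_eq_zero.1 (h _), fun h g => by rw [h, inner_zero_right]⟩

lemma starProjection_productSubmodule_orthogonal (f : HardyBidisc) :
    (productSubmodule θ₁ θ₂)ᗮ.starProjection f =
      f - h₁.mulFst (h₂.mulSnd ((h₂.mulSnd†) ((h₁.mulFst†) f))) := by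
  refine Submodule.eq_starProjection_of_mem_orthogonal ?_ ?_
  · rw [mem_productSubmodule_orthogonal_iff h₁ h₂, map_sub, map_sub, h₁.adjoint_mulFst_mulFst,
      h₂.adjoint_mulSnd_mulSnd, sub_self]
  · rw [sub_sub_cancel]
    exact Submodule.le_orthogonal_orthogonal _ ((mem_productSubmodule_iff h₁ h₂).2 ⟨_, rfl⟩)

end Inner

end HardyBidisc

lemma one_sub_conj_mul_ne_zero {b w : ℂ} (hb : ‖b‖ < 1) (hw : ‖w‖ < 1) : 1 - conj b * w ≠ 0 := by
  refine sub_ne_zero.2 fun h => ?_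
  have hlt : ‖conj b * w‖ < 1 := by
    rw [norm_mul, RCLike.norm_conj]
    exact mul_lt_one_of_nonneg_of_lt_one_left (norm_nonneg _) hb hw.le
  rw [← h, norm_one] at hlt
  exact hlt.false

namespace IsInner

variable {θ : ℂ → ℂ}

lemma exists_mul_affine_eq (h : IsInner θ)
    (hθ : (∃ c : ℂ, ∀ z ∈ Metric.ball (0 : ℂ) 1, θ z = c) ∨
      ∃ c : ℂ, ‖c‖ = 1 ∧ ∀ z ∈ Metric.ball (0 : ℂ) 1, θ z = c * z) :
    ∃ a b : ℂ, ∀ z ∈ Metric.ball (0 : ℂ) 1, θ z * (a + b * z) = z := by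
  rcases hθ with ⟨c, hc⟩ | ⟨c, hc1, hc⟩
  · have hc0 : c ≠ 0 := h.ne_zero_of_eq_const hc
    exact ⟨0, c⁻¹, fun z hz => by rw [hc z hz, zero_add, mul_inv_cancel_left₀ hc0]⟩
  · have hc0 : c ≠ 0 := norm_ne_zero_iff.1 (hc1 ▸ one_ne_zero)
    exact ⟨c⁻¹, 0, fun z hz => by rw [hc z hz, zero_mul, add_zero, mul_right_comm,
      mul_inv_cancel₀ hc0, one_mul]⟩

end IsInner

namespace HardyBidisc

open scoped InnerProduct

variable {θ₁ θ₂ : ℂ → ℂ}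

lemma isPhiDoublyCommuting_of_mul_affine_eq {a₁ b₁ a₂ b₂ : ℂ}
    (hθ₁ : ∀ z ∈ Metric.ball (0 : ℂ) 1, θ₁ z * (a₁ + b₁ * z) = z)
    (hθ₂ : ∀ w ∈ Metric.ball (0 : ℂ) 1, θ₂ w * (a₂ + b₂ * w) = w) :
    IsPhiDoublyCommuting (productSubmodule θ₁ θ₂)ᗮ := by
  have hmem (g : HardyBidisc) : M₁ (M₂ g) ∈ productSubmodule θ₁ θ₂ := by
    let g' := a₂ • g + b₂ • M₂ g
    refine ⟨a₁ • g' + b₁ • M₁ g', fun p hp => ?_⟩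
    calc p.1 * (p.2 * g p)
        = θ₁ p.1 * (a₁ + b₁ * p.1) * (θ₂ p.2 * (a₂ + b₂ * p.2) * g p) := by
          rw [hθ₁ _ hp.1, hθ₂ _ hp.2]
      _ = θ₁ p.1 * θ₂ p.2 * (a₁ • g' + b₁ • M₁ g') p := by
          simp only [g', add_apply, smul_apply, M₁_apply, M₂_apply]
          ring
  refine (isQuotientModule_productSubmodule θ₁ θ₂).isPhiDoublyCommuting_of_adjoint_eq_zero
    fun f hf => ext_inner_left ℂ fun g => ?_
  rw [ContinuousLinearMap.adjoint_inner_right, ContinuousLinearMap.adjoint_inner_right,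
    inner_zero_right]
  exact hf _ (hmem g)

lemma isPhiDoublyCommuting_of_const_or_linear (h₁ : IsInner θ₁) (h₂ : IsInner θ₂)
    (hθ₁ : (∃ c : ℂ, ∀ z ∈ Metric.ball (0 : ℂ) 1, θ₁ z = c) ∨
      ∃ c : ℂ, ‖c‖ = 1 ∧ ∀ z ∈ Metric.ball (0 : ℂ) 1, θ₁ z = c * z)
    (hθ₂ : (∃ c : ℂ, ∀ w ∈ Metric.ball (0 : ℂ) 1, θ₂ w = c) ∨
      ∃ c : ℂ, ‖c‖ = 1 ∧ ∀ w ∈ Metric.ball (0 : ℂ) 1, θ₂ w = c * w) :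
    IsPhiDoublyCommuting (productSubmodule θ₁ θ₂)ᗮ := by
  obtain ⟨a₁, b₁, hab₁⟩ := h₁.exists_mul_affine_eq hθ₁
  obtain ⟨a₂, b₂, hab₂⟩ := h₂.exists_mul_affine_eq hθ₂
  exact isPhiDoublyCommuting_of_mul_affine_eq hab₁ hab₂

lemma isPhiDoublyCommuting_of_const_of_mobius {b c₁ c₂ : ℂ} (hb : ‖b‖ < 1) (hc₁ : c₁ ≠ 0)
    (hc₂ : c₂ ≠ 0) (hθ₁ : ∀ z ∈ Metric.ball (0 : ℂ) 1, θ₁ z = c₁)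
    (hθ₂ : ∀ w ∈ Metric.ball (0 : ℂ) 1, θ₂ w = c₂ * ((w - b) / (1 - conj b * w))) :
    IsPhiDoublyCommuting (productSubmodule θ₁ θ₂)ᗮ := by
  have hmem (g : HardyBidisc) : M₂ g - b • g ∈ productSubmodule θ₁ θ₂ := by
    refine ⟨(c₁ * c₂)⁻¹ • (g - conj b • M₂ g), fun p hp => ?_⟩
    have hden := one_sub_conj_mul_ne_zero hb (mem_ball_zero_iff.1 hp.2)
    have hfac : g p - conj b * (p.2 * g p) = (1 - conj b * p.2) * g p := by ring
    simp only [sub_apply, smul_apply, M₂_apply, hθ₁ _ hp.1, hθ₂ _ hp.2, hfac]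
    generalize 1 - conj b * p.2 = d at hden ⊢
    field_simp
  refine (isQuotientModule_productSubmodule θ₁ θ₂).isPhiDoublyCommuting_of_adjoint_M₂_eq_smul
    (c := conj b) fun f hf => ext_inner_left ℂ fun g => ?_
  rw [ContinuousLinearMap.adjoint_inner_right, inner_smul_right, ← sub_eq_zero,
    ← inner_smul_left, ← inner_sub_left]
  exact hf _ (hmem g)

end HardyBidisc

namespace IsInner

open HardyBidisc
open scoped InnerProduct

variable {θ : ℂ → ℂ} (h : IsInner θ)

/-- The reproducing kernel at the origin of the model space of `θ`, as a function of `w`. -/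
noncomputable def kernelSnd : HardyBidisc := one - conj (θ 0) • h.mulSnd one

/-- The difference quotient `(θ(z) - θ(0)) / z`. -/
noncomputable def diffQuotFst : HardyBidisc := (M₁†) (h.mulFst one)

/-- The difference quotient `(θ(w) - θ(0)) / w`. -/
noncomputable def diffQuotSnd : HardyBidisc := (M₂†) (h.mulSnd one)

lemma kernelSnd_apply {p : ℂ × ℂ} (hp : p ∈ bidisc) :
    h.kernelSnd p = 1 - conj (θ 0) * θ p.2 := by
  rw [kernelSnd, sub_apply, smul_apply, mulSnd_apply, one_apply hp, mul_one]

lemma mul_diffQuotFst_apply {p : ℂ × ℂ} (hp : p ∈ bidisc) :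
    p.1 * h.diffQuotFst p = θ p.1 - θ 0 := by
  rw [← M₁_apply, diffQuotFst, M₁_adjoint_M₁_apply _ hp, mulFst_apply, mulFst_apply,
    one_apply hp, one_apply (zero_mk_mem_bidisc hp), mul_one, mul_one]

lemma adjoint_M₂_diffQuotFst : (M₂†) h.diffQuotFst = 0 := by
  rw [diffQuotFst, ← adjoint_M₁_adjoint_M₂, h.adjoint_M₂_mulFst, adjoint_M₂_one, map_zero,
    map_zero]

lemma adjoint_mulFst_diffQuotFst : (h.mulFst†) h.diffQuotFst = 0 := by
  rw [diffQuotFst, adjoint_comm h.mulFst_M₁, adjoint_mulFst_mulFst, adjoint_M₁_one]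

lemma mul_diffQuotSnd_apply {p : ℂ × ℂ} (hp : p ∈ bidisc) :
    p.2 * h.diffQuotSnd p = θ p.2 - θ 0 := by
  rw [← M₂_apply, diffQuotSnd, M₂_adjoint_M₂_apply _ hp, mulSnd_apply, mulSnd_apply,
    one_apply hp, one_apply (mk_zero_mem_bidisc hp), mul_one, mul_one]

lemma adjoint_mulSnd_kernelSnd : (h.mulSnd†) h.kernelSnd = 0 := by
  rw [kernelSnd, map_sub, map_smul, adjoint_mulSnd_one, adjoint_mulSnd_mulSnd, sub_self]

lemma adjoint_mulSnd_diffQuotSnd : (h.mulSnd†) h.diffQuotSnd = 0 := by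
  rw [diffQuotSnd, adjoint_comm h.mulSnd_M₂, adjoint_mulSnd_mulSnd, adjoint_M₂_one]

lemma adjoint_M₁_kernelSnd : (M₁†) h.kernelSnd = 0 := by
  rw [kernelSnd, map_sub, map_smul, adjoint_M₁_mulSnd, adjoint_M₁_one, map_zero, smul_zero,
    sub_zero]

lemma M₂_adjoint_M₂_kernelSnd :
    M₂ ((M₂†) h.kernelSnd) = h.kernelSnd - h.kernelSnd (0, 0) • one := ext_bidisc fun p hp => by
  rw [M₂_adjoint_M₂_apply _ hp, sub_apply, smul_apply, one_apply hp, mul_one,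
    h.kernelSnd_apply (mk_zero_mem_bidisc hp), h.kernelSnd_apply zero_mem_bidisc]

lemma inner_diffQuotSnd_kernelSnd :
    inner ℂ h.diffQuotSnd h.kernelSnd = conj (h.diffQuotSnd (0, 0)) := by
  rw [kernelSnd, inner_sub_right, inner_smul_right, ← ContinuousLinearMap.adjoint_inner_left,
    adjoint_mulSnd_diffQuotSnd, inner_zero_left, mul_zero, sub_zero, ← inner_conj_symm, inner_one]

lemma adjoint_M₂_M₂_kernelSnd_sub (c : ℂ) :
    (M₂†) (M₂ h.kernelSnd - c • h.mulSnd one) = h.kernelSnd - c • h.diffQuotSnd := by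
  rw [map_sub, map_smul, adjoint_M₂_M₂, ← diffQuotSnd]

lemma adjoint_mulSnd_M₂_kernelSnd :
    (h.mulSnd†) (M₂ h.kernelSnd) = conj (h.diffQuotSnd (0, 0)) • one := by
  have h₁ : (M₁†) ((h.mulSnd†) (M₂ h.kernelSnd)) = 0 := by
    rw [← adjoint_comm h.mulSnd_M₁, adjoint_M₁_M₂, adjoint_M₁_kernelSnd, map_zero, map_zero]
  have h₂ : (M₂†) ((h.mulSnd†) (M₂ h.kernelSnd)) = 0 := by
    rw [← adjoint_comm h.mulSnd_M₂, adjoint_M₂_M₂, adjoint_mulSnd_kernelSnd]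
  rw [eq_smul_one h₁ h₂, ← inner_one, ContinuousLinearMap.adjoint_inner_right,
    ← ContinuousLinearMap.adjoint_inner_left]
  exact congrArg (· • one) h.inner_diffQuotSnd_kernelSnd

end IsInner

namespace HardyBidisc

open scoped InnerProduct

variable {θ₁ θ₂ : ℂ → ℂ} (h₁ : IsInner θ₁) (h₂ : IsInner θ₂)

section Phi

variable (hQ : IsPhiDoublyCommuting (productSubmodule θ₁ θ₂)ᗮ)
include h₁ h₂ hQ

lemma adjoint_M₁_eq_zero_of_isPhiDoublyCommuting {f : HardyBidisc} (hf : (h₁.mulFst†) f = 0)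
    (hf₂ : (M₂†) f = 0) : (M₁†) f = 0 := by
  have hmem : f ∈ (productSubmodule θ₁ θ₂)ᗮ := by
    rw [mem_productSubmodule_orthogonal_iff h₁ h₂, hf, map_zero]
  have hmem₂ : M₂ f ∈ (productSubmodule θ₁ θ₂)ᗮ := by
    rw [mem_productSubmodule_orthogonal_iff h₁ h₂, h₁.adjoint_mulFst_M₂, hf, map_zero, map_zero]
  have hrel := (isPhiDoublyCommuting_iff.1 hQ).2 f hmem
  rw [← adjoint_M₁_adjoint_M₂, hf₂, Submodule.starProjection_eq_self_iff.2 hmem₂,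
    ← adjoint_M₁_adjoint_M₂, adjoint_M₂_M₂] at hrel
  simpa only [map_zero] using hrel.symm

lemma eq_const_or_linear_of_isPhiDoublyCommuting :
    (∃ c : ℂ, ∀ z ∈ Metric.ball (0 : ℂ) 1, θ₁ z = c) ∨
      ∃ c : ℂ, ‖c‖ = 1 ∧ ∀ z ∈ Metric.ball (0 : ℂ) 1, θ₁ z = c * z := by
  have happly (z : ℂ) (hz : z ∈ Metric.ball (0 : ℂ) 1) :
      z * h₁.diffQuotFst (z, 0) = θ₁ z - θ₁ 0 :=
    h₁.mul_diffQuotFst_apply (p := (z, 0)) ⟨hz, Metric.mem_ball_self one_pos⟩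
  have hker : (M₁†) (one - conj (θ₁ 0) • h₁.mulFst one) = 0 :=
    adjoint_M₁_eq_zero_of_isPhiDoublyCommuting h₁ h₂ hQ
      (by rw [map_sub, map_smul, h₁.adjoint_mulFst_mulFst, h₁.adjoint_mulFst_one, sub_self])
      (by rw [map_sub, map_smul, h₁.adjoint_M₂_mulFst, adjoint_M₂_one, map_zero, smul_zero,
        sub_zero])
  rw [map_sub, map_smul, adjoint_M₁_one, zero_sub, neg_eq_zero] at hker
  rcases smul_eq_zero.1 hker with h0 | h0
  · right
    have hd : (M₁†) h₁.diffQuotFst = 0 := adjoint_M₁_eq_zero_of_isPhiDoublyCommuting h₁ h₂ hQ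
      h₁.adjoint_mulFst_diffQuotFst h₁.adjoint_M₂_diffQuotFst
    have hlin (z : ℂ) (hz : z ∈ Metric.ball (0 : ℂ) 1) : θ₁ z = h₁.diffQuotFst (0, 0) * z := by
      rw [← sub_eq_self (a := θ₁ z).2 ((map_eq_zero _).1 h0), ← happly z hz, mul_comm,
        adjoint_M₁_eq_zero_iff.1 hd (z, 0) ⟨hz, Metric.mem_ball_self one_pos⟩]
    exact ⟨_, h₁.norm_eq_one_of_eq_mul .id hlin, hlin⟩
  · left
    refine ⟨θ₁ 0, fun z hz => sub_eq_zero.1 ?_⟩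
    rw [← happly z hz, IsInner.diffQuotFst, h0]
    exact mul_zero z

lemma smul_kernelSnd_eq_smul_diffQuotSnd : h₂.kernelSnd (0, 0) • h₂.kernelSnd =
    conj (h₂.diffQuotSnd (0, 0)) • h₂.diffQuotSnd := by
  have hmem : h₁.mulFst h₂.kernelSnd ∈ (productSubmodule θ₁ θ₂)ᗮ := by
    rw [mem_productSubmodule_orthogonal_iff h₁ h₂, h₁.adjoint_mulFst_mulFst,
      h₂.adjoint_mulSnd_kernelSnd]
  have hone : (productSubmodule θ₁ θ₂)ᗮ.starProjection (h₁.mulFst one) =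
      h₁.mulFst h₂.kernelSnd := by
    rw [starProjection_productSubmodule_orthogonal h₁ h₂, h₁.adjoint_mulFst_mulFst,
      h₂.adjoint_mulSnd_one, map_smul, ← map_sub, ← IsInner.kernelSnd]
  have hmem₁ : h₁.mulFst (M₁ h₂.kernelSnd) ∈ (productSubmodule θ₁ θ₂)ᗮ := by
    rw [mem_productSubmodule_orthogonal_iff h₁ h₂, h₁.adjoint_mulFst_mulFst,
      h₂.adjoint_mulSnd_M₁, h₂.adjoint_mulSnd_kernelSnd, map_zero]
  have hleft : (productSubmodule θ₁ θ₂)ᗮ.starProjection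
        (M₂ ((M₂†) ((M₁†) (h₁.mulFst (M₁ h₂.kernelSnd))))) =
      h₁.mulFst (h₂.kernelSnd - h₂.kernelSnd (0, 0) • h₂.kernelSnd) := by
    rw [h₁.mulFst_M₁, adjoint_M₁_M₁, h₁.adjoint_M₂_mulFst, ← h₁.mulFst_M₂,
      h₂.M₂_adjoint_M₂_kernelSnd, map_sub, map_sub, map_smul, map_smul, hone,
      Submodule.starProjection_eq_self_iff.2 hmem, ← map_smul, ← map_sub]
  have hproj : (productSubmodule θ₁ θ₂)ᗮ.starProjection (M₂ (h₁.mulFst (M₁ h₂.kernelSnd))) =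
      M₁ (h₁.mulFst (M₂ h₂.kernelSnd - conj (h₂.diffQuotSnd (0, 0)) • h₂.mulSnd one)) := by
    rw [starProjection_productSubmodule_orthogonal h₁ h₂, ← h₁.mulFst_M₂,
      h₁.adjoint_mulFst_mulFst, ← M₁_M₂, h₂.adjoint_mulSnd_M₁, h₂.adjoint_mulSnd_M₂_kernelSnd,
      h₂.mulSnd_M₁, h₁.mulFst_M₁, h₁.mulFst_M₁, ← map_sub, ← map_sub, map_smul]
  have hrel := (isPhiDoublyCommuting_iff.1 hQ).2 _ hmem₁
  rw [hleft, hproj, adjoint_M₁_M₁, h₁.adjoint_M₂_mulFst, h₂.adjoint_M₂_M₂_kernelSnd_sub] at hrel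
  exact sub_right_injective (h₁.mulFst_injective hrel)

end Phi

end HardyBidisc

lemma eq_mobius {a u w t : ℂ} (hu : ‖u‖ = 1) (ha : ‖a‖ < 1) (hw : ‖w‖ < 1)
    (h : w * (1 - conj a * t) = u * (t - a)) :
    t = conj u * ((w - -(u * a)) / (1 - conj (-(u * a)) * w)) := by
  have hb : ‖-(u * a)‖ < 1 := by rwa [norm_neg, norm_mul, hu, one_mul]
  have huu : conj u * u = 1 := by rw [Complex.conj_mul', hu, Complex.ofReal_one, one_pow]
  rw [← mul_div_assoc, eq_div_iff (one_sub_conj_mul_ne_zero hb hw), map_neg, map_mul]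
  linear_combination -t * huu - conj u * h

namespace IsInner

open HardyBidisc

lemma exists_mobius_of_smul_kernelSnd_eq {θ : ℂ → ℂ} (h : IsInner θ) (h0 : ‖θ 0‖ < 1)
    (hk : h.kernelSnd (0, 0) • h.kernelSnd = conj (h.diffQuotSnd (0, 0)) • h.diffQuotSnd) :
    ∃ b ∈ Metric.ball (0 : ℂ) 1, ∃ c : ℂ, ‖c‖ = 1 ∧
      ∀ w ∈ Metric.ball (0 : ℂ) 1, θ w = c * ((w - b) / (1 - conj b * w)) := by
  set n := h.kernelSnd (0, 0) with hn
  set d := h.diffQuotSnd (0, 0)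
  have hn0 : n ≠ 0 := by
    rw [hn, h.kernelSnd_apply zero_mem_bidisc]
    exact one_sub_conj_mul_ne_zero h0 h0
  have hnorm : ‖conj d / n‖ = 1 := by
    have hsq : n * n = conj d * d := congrArg (· (0, 0)) hk
    have hsq' := congrArg norm hsq
    rw [norm_mul, norm_mul, RCLike.norm_conj, mul_self_inj (norm_nonneg _) (norm_nonneg _)] at hsq'
    rw [norm_div, RCLike.norm_conj, ← hsq', div_self (norm_ne_zero_iff.2 hn0)]
  refine ⟨-(conj d / n * θ 0), ?_, conj (conj d / n), (RCLike.norm_conj _).trans hnorm,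
    fun w hw => eq_mobius hnorm h0 (mem_ball_zero_iff.1 hw) ?_⟩
  · rwa [mem_ball_zero_iff, norm_neg, norm_mul, hnorm, one_mul]
  · have hp : ((0, w) : ℂ × ℂ) ∈ bidisc := ⟨Metric.mem_ball_self one_pos, hw⟩
    have hkw : n * h.kernelSnd (0, w) = conj d * h.diffQuotSnd (0, w) := congrArg (· (0, w)) hk
    rw [h.kernelSnd_apply hp] at hkw
    rw [← h.mul_diffQuotSnd_apply hp, div_mul_eq_mul_div, eq_div_iff hn0]
    linear_combination w * hkw

end IsInner

namespace HardyBidisc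

open scoped InnerProduct

variable {θ θ₁ θ₂ : ℂ → ℂ}

lemma eq_const_or_mobius_of_isPhiDoublyCommuting (h₁ : IsInner θ₁) (h₂ : IsInner θ₂)
    (hQ : IsPhiDoublyCommuting (productSubmodule θ₁ θ₂)ᗮ) :
    (∃ c : ℂ, ∀ w ∈ Metric.ball (0 : ℂ) 1, θ₂ w = c) ∨
      ∃ b ∈ Metric.ball (0 : ℂ) 1, ∃ c : ℂ, ‖c‖ = 1 ∧
        ∀ w ∈ Metric.ball (0 : ℂ) 1, θ₂ w = c * ((w - b) / (1 - conj b * w)) :=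
  h₂.eq_const_or_norm_lt_one.imp_right fun h0 =>
    h₂.exists_mobius_of_smul_kernelSnd_eq h0 (smul_kernelSnd_eq_smul_diffQuotSnd h₁ h₂ hQ)

lemma productSubmodule_eq_of_eq_mul {c : ℂ} (hc : c ≠ 0)
    (h : ∀ z ∈ Metric.ball (0 : ℂ) 1, θ₁ z = c * θ z) :
    productSubmodule θ₁ θ₂ = productSubmodule θ θ₂ := by
  ext f
  constructor
  · rintro ⟨g, hg⟩
    refine ⟨c • g, fun p hp => ?_⟩
    rw [hg p hp, smul_apply, h _ hp.1]
    ring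
  · rintro ⟨g, hg⟩
    refine ⟨c⁻¹ • g, fun p hp => ?_⟩
    rw [hg p hp, smul_apply, h _ hp.1]
    field_simp

lemma smul_one_eq_smul_diffQuotSnd (h₂ : IsInner θ₂)
    (hQ : IsPhiDoublyCommuting (productSubmodule (fun z => z) θ₂)ᗮ) :
    h₂.kernelSnd (0, 0) • one = conj (h₂.diffQuotSnd (0, 0)) • h₂.diffQuotSnd := by
  have hproj := starProjection_productSubmodule_orthogonal .id h₂
  change ∀ f, _ = f - M₁ (h₂.mulSnd ((h₂.mulSnd†) ((M₁†) f))) at hproj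
  have hmem : M₁ h₂.kernelSnd ∈ (productSubmodule (fun z => z) θ₂)ᗮ := by
    rw [mem_productSubmodule_orthogonal_iff .id h₂]
    exact (congrArg _ (adjoint_M₁_M₁ _)).trans h₂.adjoint_mulSnd_kernelSnd
  have hleft : (productSubmodule (fun z => z) θ₂)ᗮ.starProjection
      (M₂ ((M₂†) ((M₁†) (M₁ h₂.kernelSnd)))) = h₂.kernelSnd - h₂.kernelSnd (0, 0) • one := by
    rw [adjoint_M₁_M₁, h₂.M₂_adjoint_M₂_kernelSnd, hproj, map_sub (M₁†), map_smul (M₁†),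
      h₂.adjoint_M₁_kernelSnd, adjoint_M₁_one, smul_zero, sub_zero, map_zero, map_zero, map_zero,
      sub_zero]
  have hright : (productSubmodule (fun z => z) θ₂)ᗮ.starProjection (M₂ (M₁ h₂.kernelSnd)) =
      M₁ (M₂ h₂.kernelSnd - conj (h₂.diffQuotSnd (0, 0)) • h₂.mulSnd one) := by
    rw [hproj, ← M₁_M₂, adjoint_M₁_M₁, h₂.adjoint_mulSnd_M₂_kernelSnd, ← map_sub, map_smul]
  have hrel := (isPhiDoublyCommuting_iff.1 hQ).2 _ hmem
  rw [hleft, hright, adjoint_M₁_M₁, h₂.adjoint_M₂_M₂_kernelSnd_sub] at hrel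
  exact sub_right_injective hrel

lemma eq_const_or_linear_of_isPhiDoublyCommuting_id (h₂ : IsInner θ₂)
    (hQ : IsPhiDoublyCommuting (productSubmodule (fun z => z) θ₂)ᗮ) :
    (∃ c : ℂ, ∀ w ∈ Metric.ball (0 : ℂ) 1, θ₂ w = c) ∨
      ∃ c : ℂ, ‖c‖ = 1 ∧ ∀ w ∈ Metric.ball (0 : ℂ) 1, θ₂ w = c * w := by
  refine h₂.eq_const_or_norm_lt_one.imp_right fun h0 => ?_
  have hk := smul_kernelSnd_eq_smul_diffQuotSnd .id h₂ hQ
  have hone : h₂.kernelSnd = one := by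
    refine smul_right_injective _ ?_ (hk.trans (smul_one_eq_smul_diffQuotSnd h₂ hQ).symm)
    rw [h₂.kernelSnd_apply zero_mem_bidisc]
    exact one_sub_conj_mul_ne_zero h0 h0
  obtain ⟨b, -, c, hc, hθ⟩ := h₂.exists_mobius_of_smul_kernelSnd_eq h0 hk
  have hθ0 : θ₂ 0 = 0 := by
    have h := congrArg (· (0, 0)) hone
    simpa [h₂.kernelSnd_apply zero_mem_bidisc, one_apply zero_mem_bidisc] using h
  have hb0 : b = 0 := by
    have h := hθ 0 (Metric.mem_ball_self one_pos)
    have hc0 : c ≠ 0 := norm_ne_zero_iff.1 (hc ▸ one_ne_zero)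
    simpa [hθ0, hc0] using h
  exact ⟨c, hc, fun w hw => by simpa [hb0] using hθ w hw⟩

end HardyBidisc

theorem theorem3p9 (θ₁ θ₂ : ℂ → ℂ) (h₁ : IsInner θ₁) (h₂ : IsInner θ₂) :
    HardyBidisc.IsPhiDoublyCommuting (HardyBidisc.productSubmodule θ₁ θ₂)ᗮ ↔
      ((∃ c : ℂ, ∀ z ∈ Metric.ball (0 : ℂ) 1, θ₁ z = c) ∧
        (∃ c : ℂ, ∀ w ∈ Metric.ball (0 : ℂ) 1, θ₂ w = c)) ∨
      ((∃ c : ℂ, ∀ z ∈ Metric.ball (0 : ℂ) 1, θ₁ z = c) ∧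
        (∃ b ∈ Metric.ball (0 : ℂ) 1, ∃ c : ℂ, ‖c‖ = 1 ∧
          ∀ w ∈ Metric.ball (0 : ℂ) 1, θ₂ w = c * ((w - b) / (1 - conj b * w)))) ∨
      ((∃ c : ℂ, ∀ w ∈ Metric.ball (0 : ℂ) 1, θ₂ w = c) ∧
        (∃ c₁ : ℂ, ‖c₁‖ = 1 ∧ ∀ z ∈ Metric.ball (0 : ℂ) 1, θ₁ z = c₁ * z)) ∨
      ((∃ c₁ : ℂ, ‖c₁‖ = 1 ∧ ∀ z ∈ Metric.ball (0 : ℂ) 1, θ₁ z = c₁ * z) ∧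
        (∃ c₂ : ℂ, ‖c₂‖ = 1 ∧ ∀ w ∈ Metric.ball (0 : ℂ) 1, θ₂ w = c₂ * w)) := by
  constructor
  · intro hQ
    rcases HardyBidisc.eq_const_or_linear_of_isPhiDoublyCommuting h₁ h₂ hQ with
      hconst | ⟨c, hc, hlin⟩
    · rcases HardyBidisc.eq_const_or_mobius_of_isPhiDoublyCommuting h₁ h₂ hQ with hθ₂ | hθ₂
      · exact .inl ⟨hconst, hθ₂⟩
      · exact .inr (.inl ⟨hconst, hθ₂⟩)
    · have hid := HardyBidisc.productSubmodule_eq_of_eq_mul (θ₂ := θ₂)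
        (norm_ne_zero_iff.1 (hc ▸ one_ne_zero)) hlin
      rcases HardyBidisc.eq_const_or_linear_of_isPhiDoublyCommuting_id h₂ (hid ▸ hQ) with
        hθ₂ | hθ₂
      · exact .inr (.inr (.inl ⟨hθ₂, c, hc, hlin⟩))
      · exact .inr (.inr (.inr ⟨⟨c, hc, hlin⟩, hθ₂⟩))
  · rintro (⟨hθ₁, hθ₂⟩ | ⟨⟨c₁, hθ₁⟩, b, hb, c₂, hc₂, hθ₂⟩ | ⟨hθ₂, hθ₁⟩ | ⟨hθ₁, hθ₂⟩)
    · exact HardyBidisc.isPhiDoublyCommuting_of_const_or_linear h₁ h₂ (.inl hθ₁) (.inl hθ₂)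
    · exact HardyBidisc.isPhiDoublyCommuting_of_const_of_mobius (mem_ball_zero_iff.1 hb)
        (h₁.ne_zero_of_eq_const hθ₁) (norm_ne_zero_iff.1 (hc₂ ▸ one_ne_zero)) hθ₁ hθ₂
    · exact HardyBidisc.isPhiDoublyCommuting_of_const_or_linear h₁ h₂ (.inr hθ₁) (.inl hθ₂)
    · exact HardyBidisc.isPhiDoublyCommuting_of_const_or_linear h₁ h₂ (.inr hθ₁) (.inr hθ₂)
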